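/- There is a constant $c>0$ such that for every even $d\ge 2$ there are two $d$-polytopes $P_1,P_2\subseteq\mathbb{R}^d$ with exactly $d^2$ facets each, whose Cayley embedding $\operatorname{conv}\big((P_1\times\{0\})\cup(P_2\times\{1\})\big)\subseteq\mathbb{R}^{d+1}$ is a $(d+1)$-polytope with at least $d^{cd}$ facets. Moreover, they can be constructed as follows. Let $d\ge2$ be even, let $t_1,\dots,t_{d^2}$ be pairwise distinct real numbers, let $x(t)=(t,t^2,\dots,t^d)$, and let $C=\operatorname{conv}\{x(t_1),\dots,x(t_{d^2})\}$ be the cyclic polytope. Then $C$ has an interior point. Let $v$ be any interior point of $C$, let $a_m=x(t_m)-v$, and let $P_1=\{y\in\mathbb{R}^d: zy\le 1\ \text{for all } z\in C-v\}$ be the polar of $C-v$. Partition the indices $1,\dots,d^2$ arbitrarily into $d/2$ colour classes of size $2d$, and let $\kappa(m)$ be the class of $m$. For a nonempty face $F$ of $P_1$, let $\overline C_{P_1}(F)$ be the set of all $c\in\mathbb{R}^d$ for which the set of maximizers of $x\mapsto cx$ over $P_1$ contains $F$. Then for every $\varepsilon>0$ there are vectors $u_1,\dots,u_{d/2}\in\mathbb{R}^d$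 of norm less than $\varepsilon$ which are affinely independent, whose convex hull has $0$ in its relative interior, and which lie in a $d/2$-dimensional linear subspace $V$ with $V\cap\operatorname{aff}\overline C_{P_1}(F)=\{0\}$ for every $d/2$-dimensional face $F$ of $P_1$, such that, with $b_m=a_m+u_{\kappa(m)}$ and $P_2=\{x\in\mathbb{R}^d: b_mx\le1 \text{ for all } m\}$, the following hold. 1. $P_1$ and $P_2$ are $d$-polytopes with exactly $d^2$ facets each; the facets are the sets $\{x\in P_1:a_mx=1\}$ and $\{x\in P_2:b_mx=1\}$, respectively, $m=1,\dots,d^2$. Their Cayley embedding is a $(d+1)$-polytope. 2. For every choice of indices $i_1,\dots,i_{d/2}$ with $\kappa(i_j)=j$, the set $F=\{x\in P_1: a_{i_j}x=1\ \forall j\}$ (a *colorful face*) is a $d/2$-dimensional face of $P_1$, the set $F'=\{x\in P_2: b_{i_j}x=1\ \forall j\}$ is a $d/2$-dimensional face of $P_2$, and the Cayley embedding of $F$ and $F'$ is a facet of the Cayley embedding of $P_1$ and $P_2$. 3. There are exactly $(2d)^{d/2}$ colorful faces of $P_1$, and exactly $(2d)^{d/2}$ facets of the Cayley embedding arise from them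 as in 2; in particular the Cayley embedding has at least $(2d)^{d/2}$ facets. -/

import Mathlib

noncomputable section

namespace CayleyConstruction

/-- The affine dimension of a (nonempty) set, i.e. the dimension of its affine hull. -/
def affDim {n : ℕ} (S : Set (EuclideanSpace ℝ (Fin n))) : ℕ :=
  Module.finrank ℝ (affineSpan ℝ S).direction

/-- A polytope: the convex hull of finitely many points. -/
def IsPolytope {n : ℕ} (P : Set (EuclideanSpace ℝ (Fin n))) : Prop :=
  ∃ s : Finset (EuclideanSpace ℝ (Fin n)), P = convexHull ℝ (s : Set (EuclideanSpace ℝ (Fin n)))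

/-- A `k`-polytope: a nonempty polytope of dimension `k`. -/
def IsKPolytope {n : ℕ} (k : ℕ) (P : Set (EuclideanSpace ℝ (Fin n))) : Prop :=
  IsPolytope P ∧ P.Nonempty ∧ affDim P = k

/-- The inequality `c x ≤ δ` defines the subset `F` of `P`. -/
def Defines {n : ℕ} (c : EuclideanSpace ℝ (Fin n)) (δ : ℝ)
    (P F : Set (EuclideanSpace ℝ (Fin n))) : Prop :=
  P ⊆ {x | inner ℝ c x ≤ δ} ∧ F = P ∩ {x | inner ℝ c x = δ}

/-- `F` is a nonempty face of `P` (`P` itself is allowed, through `c = 0`, `δ = 0`). -/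
def IsFace {n : ℕ} (P F : Set (EuclideanSpace ℝ (Fin n))) : Prop :=
  F.Nonempty ∧ ∃ (c : EuclideanSpace ℝ (Fin n)) (δ : ℝ), Defines c δ P F

/-- `F` is a face of `P` of dimension `k`. -/
def IsKFace {n : ℕ} (k : ℕ) (P F : Set (EuclideanSpace ℝ (Fin n))) : Prop :=
  IsFace P F ∧ affDim F = k

/-- The facets of `P`: its faces of dimension `dim P - 1`. -/
def facets {n : ℕ} (P : Set (EuclideanSpace ℝ (Fin n))) :
    Set (Set (EuclideanSpace ℝ (Fin n))) :=
  {F | IsFace P F ∧ affDim F + 1 = affDim P}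

/-- The optimality cone `C_P(F)`: the normals of the inequalities that define `F`. -/
def optCone {n : ℕ} (P F : Set (EuclideanSpace ℝ (Fin n))) :
    Set (EuclideanSpace ℝ (Fin n)) :=
  {c | ∃ δ : ℝ, Defines c δ P F}

/-- The union of the optimality cones of all nonempty faces of `P` that contain `F`. -/
def closedOptCone {n : ℕ} (P F : Set (EuclideanSpace ℝ (Fin n))) :
    Set (EuclideanSpace ℝ (Fin n)) :=
  {c | ∃ F' : Set (EuclideanSpace ℝ (Fin n)), IsFace P F' ∧ F ⊆ F' ∧ c ∈ optCone P F'}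

/-- The point `(x, α)` of `ℝ^(n+1)`, for `x` in `ℝ^n`. -/
def lift {n : ℕ} (α : ℝ) (x : EuclideanSpace ℝ (Fin n)) : EuclideanSpace ℝ (Fin (n + 1)) :=
  WithLp.toLp 2 (Fin.snoc (α := fun _ => ℝ) (fun i => x i) α)

/-- The Cayley embedding `conv (P × {0} ∪ Q × {1})`. -/
def cayley {n : ℕ} (P Q : Set (EuclideanSpace ℝ (Fin n))) :
    Set (EuclideanSpace ℝ (Fin (n + 1))) :=
  convexHull ℝ (lift 0 '' P ∪ lift 1 '' Q)

/-- The moment curve `t ↦ (t, t², …, t^d)`. -/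
def momentCurve (d : ℕ) (t : ℝ) : EuclideanSpace ℝ (Fin d) :=
  WithLp.toLp 2 (fun i : Fin d => t ^ ((i : ℕ) + 1))

/-- The convex hull of the points of the moment curve with parameters `t 0, …, t (k - 1)`. -/
def cyclicPolytope (d : ℕ) {k : ℕ} (t : Fin k → ℝ) : Set (EuclideanSpace ℝ (Fin d)) :=
  convexHull ℝ (Set.range fun m => momentCurve d (t m))

/-- The polar set `{y | x y ≤ 1 for all x in S}`. -/
def polarSet {n : ℕ} (S : Set (EuclideanSpace ℝ (Fin n))) : Set (EuclideanSpace ℝ (Fin n)) :=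
  {y | ∀ x ∈ S, inner ℝ x y ≤ 1}

/-- The polar of the cyclic polytope translated by `-v`. -/
def polarCyclic (d : ℕ) {k : ℕ} (t : Fin k → ℝ) (v : EuclideanSpace ℝ (Fin d)) :
    Set (EuclideanSpace ℝ (Fin d)) :=
  polarSet ((fun x => x - v) '' cyclicPolytope d t)

/-- The vertices of the translated cyclic polytope; these are the normals in the description
`{x | a m x ≤ 1 for all m}` of its polar. -/
def normals (d : ℕ) {k : ℕ} (t : Fin k → ℝ) (v : EuclideanSpace ℝ (Fin d)) :
    Fin k → EuclideanSpace ℝ (Fin d) :=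
  fun m => momentCurve d (t m) - v

/-- The normals after the normals of colour `j` have all been shifted by `u j`. -/
def shiftedNormals {d k l : ℕ} (a : Fin k → EuclideanSpace ℝ (Fin d)) (κ : Fin k → Fin l)
    (u : Fin l → EuclideanSpace ℝ (Fin d)) : Fin k → EuclideanSpace ℝ (Fin d) :=
  fun m => a m + u (κ m)

/-- The polyhedron `{x | a m x ≤ 1 for all m}`. -/
def polyhedron {d k : ℕ} (a : Fin k → EuclideanSpace ℝ (Fin d)) :
    Set (EuclideanSpace ℝ (Fin d)) :=
  {x | ∀ m, inner ℝ (a m) x ≤ 1}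

/-- A partition of the `d²` indices into `d/2` colour classes of size `2d`. -/
def IsBalancedColoring (d : ℕ) (κ : Fin (d ^ 2) → Fin (d / 2)) : Prop :=
  ∀ j : Fin (d / 2), {m | κ m = j}.ncard = 2 * d

/-- A choice of one index in each colour class. -/
def IsSelection {k l : ℕ} (κ : Fin k → Fin l) (i : Fin l → Fin k) : Prop :=
  ∀ j, κ (i j) = j

/-- The subset `{x ∈ P | a (i j) x = 1 for all j}` of `P`. -/
def tightSet {d k l : ℕ} (P : Set (EuclideanSpace ℝ (Fin d)))
    (a : Fin k → EuclideanSpace ℝ (Fin d)) (i : Fin l → Fin k) :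
    Set (EuclideanSpace ℝ (Fin d)) :=
  {x | x ∈ P ∧ ∀ j, inner ℝ (a (i j)) x = 1}

/-- The shift vectors allowed for the `d`-polytope `D`: the vertices of a simplex with `d/2`
vertices that has `0` in its relative interior and lies in a `d/2`-dimensional linear subspace `V`
which meets the affine hull of the (closed) optimality cone of each `d/2`-face of `D` only
in `0`. -/
def IsAdmissibleShift {d : ℕ} (D : Set (EuclideanSpace ℝ (Fin d)))
    (u : Fin (d / 2) → EuclideanSpace ℝ (Fin d)) : Prop :=
  (∃ V : Submodule ℝ (EuclideanSpace ℝ (Fin d)),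
    Module.finrank ℝ V = d / 2 ∧
    (∀ F, IsKFace (d / 2) D F →
      (V : Set (EuclideanSpace ℝ (Fin d))) ∩ (affineSpan ℝ (closedOptCone D F)) = {0}) ∧
    ∀ j, u j ∈ V) ∧
  AffineIndependent ℝ u ∧
  (0 : EuclideanSpace ℝ (Fin d)) ∈ intrinsicInterior ℝ (convexHull ℝ (Set.range u))

end CayleyConstruction

end

open Module Filter Topology

namespace CayleyConstruction

/-! ### Faces of a polyhedron and their normal spaces -/

section Faces

variable {n k : ℕ}

/-! A polynomial of degree at most `d` is an affine function on the moment curve. For at most `d/2`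
indices `S`, the product of the squares `(X - t s)²` has such a degree and supports the cyclic
polytope exactly at the chosen vertices. Dually, any `d/2` or fewer inequalities of `P₁` are exactly
the tight ones at some point (`isNeighborly_normals`). Then the face where those in `S` are tight
has codimension `|S|`, and its normal space is the span of the `a m` with `m ∈ S`. This
neighborliness, and the coercivity that bounds the polyhedron, survive small changes of the normals,
so `P₂` has them too when the shifts are small.

A vector of `ℝ^(d+1)` normal to the Cayley embedding of `F` and `G` is determined by a common normal
of `F` and `G`. Hence that embedding has dimension `d + 1` minus the dimension of the common normal
space (`affDim_cayley`), and a face of this form is a facet of the full-dimensional Cayley polytope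
when the common normals form a line.

For corresponding colorful faces the normal spaces are spanned by the `a (i j)` and by the `a (i j)
+ u j`. Take the `u j` affinely independent with sum `0`, in a space `V` that meets the first span
only in `0`. A common vector `∑ ν j (a (i j) + u j)` then has `∑ ν j u j = 0`, so all `ν j` are
equal, and only the line through `∑ a (i j)` remains (`span_inf_span_add_eq`). Since the shifts
cancel, this same vector defines both faces with the same right-hand side `d/2`. Distinct selections
give distinct facets, because the slice of the facet at height `0` is the colorful face of `P₁`. -/

theorem mem_orthogonal_vectorSpan {S : Set (EuclideanSpace ℝ (Fin n))}
    {w : EuclideanSpace ℝ (Fin n)} :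
    w ∈ (vectorSpan ℝ S)ᗮ ↔ ∀ x ∈ S, ∀ y ∈ S, inner ℝ w x = inner ℝ w y := by
  rw [vectorSpan, Submodule.mem_orthogonal']
  constructor
  · intro h x hx y hy
    have := h (x -ᵥ y) (Submodule.subset_span (Set.vsub_mem_vsub hx hy))
    rw [vsub_eq_sub, inner_sub_right] at this
    linarith
  · intro h z hz
    induction hz using Submodule.span_induction with
    | mem z hz =>
      obtain ⟨x, hx, y, hy, rfl⟩ := hz
      change inner ℝ w (x - y) = 0
      rw [inner_sub_right, h x hx y hy, sub_self]
    | zero => simp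
    | add x y _ _ hx hy => rw [inner_add_right, hx, hy, add_zero]
    | smul c x _ hx => rw [inner_smul_right, hx, mul_zero]

theorem affDim_add_finrank_orthogonal (S : Set (EuclideanSpace ℝ (Fin n))) :
    affDim S + finrank ℝ (vectorSpan ℝ S)ᗮ = n := by
  rw [affDim, direction_affineSpan, Submodule.finrank_add_finrank_orthogonal,
    finrank_euclideanSpace_fin]

theorem convex_polyhedron (a : Fin k → EuclideanSpace ℝ (Fin n)) : Convex ℝ (polyhedron a) := by
  intro x hx y hy s t hs ht hst m
  rw [inner_add_right, inner_smul_right, inner_smul_right]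
  nlinarith [mul_le_mul_of_nonneg_left (hx m) hs, mul_le_mul_of_nonneg_left (hy m) ht]

theorem isClosed_polyhedron (a : Fin k → EuclideanSpace ℝ (Fin n)) :
    IsClosed (polyhedron a) := by
  have : polyhedron a = ⋂ m, {x | inner ℝ (a m) x ≤ 1} := by
    ext x; simp [polyhedron]
  rw [this]
  exact isClosed_iInter fun m => isClosed_le (by fun_prop) (by fun_prop)

theorem Defines.convex {c : EuclideanSpace ℝ (Fin n)} {δ : ℝ}
    {P F : Set (EuclideanSpace ℝ (Fin n))} (h : Defines c δ P F) (hP : Convex ℝ P) :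
    Convex ℝ F := by
  rw [h.2]
  refine hP.inter fun x hx y hy s t hs ht hst => ?_
  simp only [Set.mem_ofPred_eq] at hx hy ⊢
  rw [inner_add_right, inner_smul_right, inner_smul_right, hx, hy, ← add_mul, hst, one_mul]

/-- The indices of the inequalities that hold with equality on all of `F`. -/
def tightIndices (a : Fin k → EuclideanSpace ℝ (Fin n)) (F : Set (EuclideanSpace ℝ (Fin n))) :
    Set (Fin k) :=
  {m | ∀ x ∈ F, inner ℝ (a m) x = 1}

/-- A midpoint inherits every strict inequality of either endpoint, so the finitely many non-tight
inequalities can be made strict one at a time. -/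
theorem exists_mem_lt_one {a : Fin k → EuclideanSpace ℝ (Fin n)}
    {F : Set (EuclideanSpace ℝ (Fin n))} (hF : F.Nonempty) (hconv : Convex ℝ F)
    (hsub : F ⊆ polyhedron a) :
    ∃ x ∈ F, ∀ m ∉ tightIndices a F, inner ℝ (a m) x < 1 := by
  classical
  suffices H : ∀ S : Finset (Fin k), ∃ x ∈ F, ∀ m ∈ S, m ∉ tightIndices a F →
      inner ℝ (a m) x < 1 by
    obtain ⟨x, hx, h⟩ := H Finset.univ
    exact ⟨x, hx, fun m hm => h m (Finset.mem_univ m) hm⟩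
  intro S
  induction S using Finset.induction_on with
  | empty =>
    obtain ⟨x, hx⟩ := hF
    exact ⟨x, hx, by simp⟩
  | insert j S _ ih =>
    obtain ⟨x, hx, h⟩ := ih
    by_cases hj : j ∈ tightIndices a F
    · refine ⟨x, hx, fun m hm hmt => h m ?_ hmt⟩
      rcases Finset.mem_insert.1 hm with rfl | hm
      · exact absurd hj hmt
      · exact hm
    · obtain ⟨y, hy, hyj⟩ : ∃ y ∈ F, inner ℝ (a j) y ≠ 1 := by
        simpa [tightIndices] using hj
      refine ⟨(1 / 2 : ℝ) • x + (1 / 2 : ℝ) • y,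
        hconv hx hy (by norm_num) (by norm_num) (by norm_num), fun m hm hmt => ?_⟩
      rw [inner_add_right, inner_smul_right, inner_smul_right]
      have h1 := hsub hx m
      have h2 := hsub hy m
      rcases Finset.mem_insert.1 hm with rfl | hm
      · have := lt_of_le_of_ne h2 hyj
        linarith
      · have := h m hm hmt
        linarith

/-- Slack inequalities survive a small move, and tight ones are constant along `w`. Having both
signs makes `x` a midpoint inside the polyhedron. -/
theorem exists_pos_add_smul_mem_polyhedron {a : Fin k → EuclideanSpace ℝ (Fin n)}
    {x w : EuclideanSpace ℝ (Fin n)}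
    (h : ∀ m, inner ℝ (a m) x < 1 ∨ inner ℝ (a m) x = 1 ∧ inner ℝ (a m) w = 0) :
    ∃ s : ℝ, 0 < s ∧ x + s • w ∈ polyhedron a ∧ x - s • w ∈ polyhedron a := by
  have key : ∀ w' : EuclideanSpace ℝ (Fin n),
      (∀ m, inner ℝ (a m) x < 1 ∨ inner ℝ (a m) x = 1 ∧ inner ℝ (a m) w' = 0) →
      ∀ᶠ s : ℝ in 𝓝 0, x + s • w' ∈ polyhedron a := by
    intro w' h'
    refine eventually_all.2 fun m => ?_
    rcases h' m with hm | ⟨hm, hw⟩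
    · have hc : Continuous fun s : ℝ => inner ℝ (a m) (x + s • w') := by fun_prop
      have : ∀ᶠ s : ℝ in 𝓝 0, inner ℝ (a m) (x + s • w') < 1 :=
        hc.continuousAt.eventually_lt continuousAt_const (by simpa using hm)
      exact this.mono fun s hs => hs.le
    · exact Eventually.of_forall fun s => by
        rw [inner_add_right, inner_smul_right, hm, hw]; simp
  have h1 := key w h
  have h2 := key (-w) fun m => (h m).imp id fun ⟨e, e'⟩ => ⟨e, by rw [inner_neg_right, e', neg_zero]⟩
  obtain ⟨s, ⟨hs1, hs2⟩, hs⟩ :=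
    (((h1.and h2).filter_mono nhdsWithin_le_nhds).and
      (self_mem_nhdsWithin (s := Set.Ioi (0 : ℝ)))).exists
  exact ⟨s, hs, hs1, by simpa [sub_eq_add_neg] using hs2⟩

/-- From a point of `F` with no accidental equalities one can move both ways along any `w`
orthogonal to the tight normals. The form `c` is maximal at the midpoint, hence constant along `w`,
and the move stays in `F`. -/
theorem vectorSpan_eq_of_isFace {a : Fin k → EuclideanSpace ℝ (Fin n)}
    {F : Set (EuclideanSpace ℝ (Fin n))} (hF : IsFace (polyhedron a) F) :
    vectorSpan ℝ F = (Submodule.span ℝ (a '' tightIndices a F))ᗮ := by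
  obtain ⟨hne, c, δ, hd⟩ := hF
  have hsub : F ⊆ polyhedron a := by rw [hd.2]; exact Set.inter_subset_left
  apply le_antisymm
  · rw [← Submodule.orthogonal_le_orthogonal_iff, Submodule.orthogonal_orthogonal,
      Submodule.span_le]
    rintro _ ⟨m, hm, rfl⟩
    exact mem_orthogonal_vectorSpan.2 fun x hx y hy => by rw [hm x hx, hm y hy]
  · intro w hw
    obtain ⟨x, hx, hlt⟩ := exists_mem_lt_one hne (hd.convex (convex_polyhedron a)) hsub
    have hw' : ∀ m, m ∈ tightIndices a F → inner ℝ (a m) w = 0 := fun m hm =>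
      (Submodule.mem_orthogonal _ _).1 hw _ (Submodule.subset_span ⟨m, hm, rfl⟩)
    obtain ⟨s, hs, h1, h2⟩ := exists_pos_add_smul_mem_polyhedron (a := a) (x := x) (w := w)
      fun m => by
        by_cases hm : m ∈ tightIndices a F
        · exact Or.inr ⟨hm x hx, hw' m hm⟩
        · exact Or.inl (hlt m hm)
    have hcx : inner ℝ c x = δ := by rw [hd.2] at hx; exact hx.2
    have e1 := hd.1 h1
    have e2 := hd.1 h2
    simp only [Set.mem_ofPred_eq, inner_add_right, inner_sub_right, hcx] at e1 e2
    have e3 : inner ℝ c (s • w) = 0 := by linarith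
    have hmem : x + s • w ∈ F := by
      rw [hd.2]
      exact ⟨h1, by simp [inner_add_right, hcx, e3]⟩
    have := vsub_mem_vectorSpan ℝ hmem hx
    rw [vsub_eq_sub, add_sub_cancel_left] at this
    exact (Submodule.smul_mem_iff _ hs.ne').1 this

theorem orthogonal_vectorSpan_of_isFace {a : Fin k → EuclideanSpace ℝ (Fin n)}
    {F : Set (EuclideanSpace ℝ (Fin n))} (hF : IsFace (polyhedron a) F) :
    (vectorSpan ℝ F)ᗮ = Submodule.span ℝ (a '' tightIndices a F) := by
  rw [vectorSpan_eq_of_isFace hF, Submodule.orthogonal_orthogonal]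

/-- Some point satisfies exactly the inequalities with index in `S` with equality. -/
def HasExactPoint (a : Fin k → EuclideanSpace ℝ (Fin n)) (S : Finset (Fin k)) : Prop :=
  ∃ x, (∀ m ∈ S, inner ℝ (a m) x = 1) ∧ ∀ m ∉ S, inner ℝ (a m) x < 1

/-- Any `r` of the inequalities are exactly the tight ones at some point. -/
def IsNeighborly (r : ℕ) (a : Fin k → EuclideanSpace ℝ (Fin n)) : Prop :=
  ∀ S : Finset (Fin k), S.card ≤ r → HasExactPoint a S

theorem IsNeighborly.mono {r r' : ℕ} {a : Fin k → EuclideanSpace ℝ (Fin n)}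
    (h : IsNeighborly r a) (hr : r' ≤ r) : IsNeighborly r' a :=
  fun S hS => h S (hS.trans hr)

theorem IsNeighborly.eq_zero_of_sum_smul_eq_zero {r : ℕ} {a : Fin k → EuclideanSpace ℝ (Fin n)}
    (h : IsNeighborly r a) {S : Finset (Fin k)} (hS : S.card ≤ r) {g : Fin k → ℝ}
    (hg : ∑ m ∈ S, g m • a m = 0) : ∀ m ∈ S, g m = 0 := by
  classical
  intro m hm
  obtain ⟨x, hx, -⟩ := h S hS
  -- At `x` all of `S` is tight, at `y` all of `S` but `m`. Evaluating the relation at both points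
  -- and subtracting leaves `g m * (1 - ⟨a m, y⟩) = 0` with a nonzero second factor.
  obtain ⟨y, hy, hy'⟩ := h (S.erase m) ((Finset.card_erase_le).trans hS)
  have e : ∀ z, ∑ j ∈ S, g j * inner ℝ (a j) z = 0 := fun z => by
    have := congrArg (fun w => inner ℝ w z) hg
    simpa [sum_inner, inner_smul_left] using this
  have e1 := e x
  have e2 := e y
  rw [← Finset.add_sum_erase _ _ hm] at e1 e2
  rw [hx m hm] at e1
  rw [Finset.sum_congr rfl fun j hj => by rw [hx j (Finset.mem_of_mem_erase hj)]] at e1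
  rw [Finset.sum_congr rfl fun j hj => by rw [hy j hj]] at e2
  have h3 := hy' m (Finset.notMem_erase m S)
  have h4 : g m * (1 - inner ℝ (a m) y) = 0 := by linarith
  rcases mul_eq_zero.1 h4 with h5 | h5
  · exact h5
  · linarith

theorem IsNeighborly.linearIndependent {r : ℕ} {a : Fin k → EuclideanSpace ℝ (Fin n)}
    (h : IsNeighborly r a) {S : Finset (Fin k)} (hS : S.card ≤ r) :
    LinearIndepOn ℝ a (S : Set (Fin k)) := by
  rw [linearIndepOn_finset_iff]
  exact fun g hg => h.eq_zero_of_sum_smul_eq_zero hS hg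

theorem IsNeighborly.finrank_span {r : ℕ} {a : Fin k → EuclideanSpace ℝ (Fin n)}
    (h : IsNeighborly r a) {S : Finset (Fin k)} (hS : S.card ≤ r) :
    finrank ℝ (Submodule.span ℝ (a '' (S : Set (Fin k)))) = S.card := by
  have := finrank_span_eq_card (h.linearIndependent hS)
  rw [← Set.image_eq_range] at this
  simpa using this

/-- The points of `P` at which the inequalities with index in `S` are tight. -/
def tightFace (P : Set (EuclideanSpace ℝ (Fin n))) (a : Fin k → EuclideanSpace ℝ (Fin n))
    (S : Finset (Fin k)) : Set (EuclideanSpace ℝ (Fin n)) :=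
  {x | x ∈ P ∧ ∀ m ∈ S, inner ℝ (a m) x = 1}

/-- A sum of inequalities is tight only if each summand is. -/
theorem defines_tightFace (a : Fin k → EuclideanSpace ℝ (Fin n)) (S : Finset (Fin k)) :
    Defines (∑ m ∈ S, a m) S.card (polyhedron a) (tightFace (polyhedron a) a S) := by
  have hle : ∀ x ∈ polyhedron a, ∑ m ∈ S, inner ℝ (a m) x ≤ ∑ m ∈ S, (1 : ℝ) :=
    fun x hx => Finset.sum_le_sum fun m _ => hx m
  refine ⟨fun x hx => ?_, ?_⟩
  · simpa [sum_inner] using hle x hx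
  · ext x
    simp only [tightFace, Set.mem_inter_iff, Set.mem_ofPred_eq, sum_inner]
    refine and_congr_right fun hx => ?_
    have := Finset.sum_eq_sum_iff_of_le (s := S) (f := fun m => inner ℝ (a m) x)
      (g := fun _ => (1 : ℝ)) fun m _ => hx m
    rw [← this]
    simp

theorem HasExactPoint.nonempty_tightFace {a : Fin k → EuclideanSpace ℝ (Fin n)}
    {S : Finset (Fin k)} (h : HasExactPoint a S) : (tightFace (polyhedron a) a S).Nonempty := by
  obtain ⟨x, hx, hx'⟩ := h
  refine ⟨x, fun m => ?_, hx⟩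
  by_cases hm : m ∈ S
  · exact (hx m hm).le
  · exact (hx' m hm).le

theorem HasExactPoint.isFace {a : Fin k → EuclideanSpace ℝ (Fin n)}
    {S : Finset (Fin k)} (h : HasExactPoint a S) :
    IsFace (polyhedron a) (tightFace (polyhedron a) a S) :=
  ⟨h.nonempty_tightFace, _, _, defines_tightFace a S⟩

theorem HasExactPoint.tightIndices_tightFace {a : Fin k → EuclideanSpace ℝ (Fin n)}
    {S : Finset (Fin k)} (h : HasExactPoint a S) :
    tightIndices a (tightFace (polyhedron a) a S) = S := by
  ext m
  refine ⟨fun hm => ?_, fun hm x hx => hx.2 m hm⟩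
  by_contra hmS
  obtain ⟨x, hx, hx'⟩ := h
  have hxP : x ∈ polyhedron a := fun j => by
    by_cases hj : j ∈ S
    · exact (hx j hj).le
    · exact (hx' j hj).le
  exact (hx' m hmS).ne (hm x ⟨hxP, hx⟩)

theorem tightFace_injective {r : ℕ} {a : Fin k → EuclideanSpace ℝ (Fin n)}
    (h : IsNeighborly r a) {S T : Finset (Fin k)} (hS : S.card ≤ r) (hT : T.card ≤ r)
    (e : tightFace (polyhedron a) a S = tightFace (polyhedron a) a T) : S = T := by
  rw [← Finset.coe_inj, ← (h S hS).tightIndices_tightFace, e, (h T hT).tightIndices_tightFace]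

theorem IsNeighborly.orthogonal_vectorSpan {r : ℕ} {a : Fin k → EuclideanSpace ℝ (Fin n)}
    (h : IsNeighborly r a) {S : Finset (Fin k)} (hS : S.card ≤ r) :
    (vectorSpan ℝ (tightFace (polyhedron a) a S))ᗮ =
      Submodule.span ℝ (a '' (S : Set (Fin k))) := by
  rw [orthogonal_vectorSpan_of_isFace (h S hS).isFace, (h S hS).tightIndices_tightFace]

theorem IsNeighborly.affDim_tightFace {r : ℕ} {a : Fin k → EuclideanSpace ℝ (Fin n)}
    (h : IsNeighborly r a) {S : Finset (Fin k)} (hS : S.card ≤ r) :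
    affDim (tightFace (polyhedron a) a S) + S.card = n := by
  rw [← h.finrank_span hS, ← h.orthogonal_vectorSpan hS, affDim_add_finrank_orthogonal]

theorem tightFace_empty (a : Fin k → EuclideanSpace ℝ (Fin n)) :
    tightFace (polyhedron a) a ∅ = polyhedron a := by
  simp [tightFace]

theorem IsNeighborly.vectorSpan_polyhedron {r : ℕ} {a : Fin k → EuclideanSpace ℝ (Fin n)}
    (h : IsNeighborly r a) : (vectorSpan ℝ (polyhedron a))ᗮ = ⊥ := by
  have := h.orthogonal_vectorSpan (S := ∅) (by simp)
  simpa [tightFace_empty] using this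

theorem IsNeighborly.affDim_polyhedron {r : ℕ} {a : Fin k → EuclideanSpace ℝ (Fin n)}
    (h : IsNeighborly r a) : affDim (polyhedron a) = n := by
  have := h.affDim_tightFace (S := ∅) (by simp)
  simpa [tightFace_empty] using this

theorem zero_mem_polyhedron (a : Fin k → EuclideanSpace ℝ (Fin n)) :
    (0 : EuclideanSpace ℝ (Fin n)) ∈ polyhedron a := fun m => by simp

theorem IsNeighborly.facets_polyhedron {a : Fin k → EuclideanSpace ℝ (Fin n)}
    (h : IsNeighborly 1 a) :
    facets (polyhedron a) =
      Set.range (fun m => {x | x ∈ polyhedron a ∧ inner ℝ (a m) x = 1}) := by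
  have hset : ∀ m, {x | x ∈ polyhedron a ∧ inner ℝ (a m) x = 1} =
      tightFace (polyhedron a) a {m} := fun m => by simp [tightFace]
  ext F
  constructor
  · rintro ⟨hF, hdim⟩
    rw [h.affDim_polyhedron] at hdim
    have hort := orthogonal_vectorSpan_of_isFace hF
    have hfr : finrank ℝ (Submodule.span ℝ (a '' tightIndices a F)) = 1 := by
      have := affDim_add_finrank_orthogonal F
      rw [hort] at this
      omega
    have hne : (tightIndices a F).Nonempty := by
      rw [Set.nonempty_iff_ne_empty]
      intro he
      rw [he, Set.image_empty, Submodule.span_empty, finrank_bot] at hfr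
      exact zero_ne_one hfr
    obtain ⟨m, hm⟩ := hne
    have ham : a m ≠ 0 := by
      obtain ⟨x, hx, -⟩ := h {m} (by simp)
      intro h0
      simpa [h0] using hx m (by simp)
    have hspan : Submodule.span ℝ {a m} = Submodule.span ℝ (a '' tightIndices a F) :=
      Submodule.eq_of_le_of_finrank_eq (Submodule.span_mono (by simpa using ⟨m, hm, rfl⟩))
        (by rw [hfr, finrank_span_singleton ham])
    obtain ⟨⟨y, hy⟩, c, δ, hd⟩ := hF
    have hyP : inner ℝ c y = δ := by
      have hy' := hy
      rw [hd.2] at hy'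
      exact hy'.2
    have hc : c ∈ Submodule.span ℝ {a m} := by
      rw [hspan, ← hort, mem_orthogonal_vectorSpan]
      intro x hx z hz
      rw [hd.2] at hx hz
      rw [hx.2, hz.2]
    obtain ⟨q, rfl⟩ := Submodule.mem_span_singleton.1 hc
    have hq : q = δ := by
      rw [inner_smul_left, hm y hy] at hyP
      simpa using hyP
    refine ⟨m, ?_⟩
    -- Otherwise the face is the whole polyhedron and contains `0`, where no inequality is tight.
    have hq0 : q ≠ 0 := by
      intro h0
      subst hq
      have hFP : F = polyhedron a := by
        rw [hd.2]; ext x; simp [h0]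
      have : (1 : ℝ) = 0 := by
        rw [← hm 0 (hFP ▸ zero_mem_polyhedron a), inner_zero_right]
      norm_num at this
    rw [hd.2, ← hq]
    ext x
    simp [inner_smul_left, hq0]
  · rintro ⟨m, rfl⟩
    change {x | x ∈ polyhedron a ∧ inner ℝ (a m) x = 1} ∈ _
    rw [hset]
    refine ⟨(h {m} (by simp)).isFace, ?_⟩
    rw [h.affDim_polyhedron]
    simpa using h.affDim_tightFace (S := {m}) (by simp)

theorem IsNeighborly.ncard_facets {a : Fin k → EuclideanSpace ℝ (Fin n)}
    (h : IsNeighborly 1 a) : (facets (polyhedron a)).ncard = k := by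
  rw [h.facets_polyhedron, Set.ncard_range_of_injective, Nat.card_fin]
  intro m m' e
  have : tightFace (polyhedron a) a {m} = tightFace (polyhedron a) a {m'} := by
    simpa [tightFace] using e
  simpa using tightFace_injective h (by simp) (by simp) this

/-- The largest of the linear forms `a m` grows at least linearly. -/
def IsCoercive (a : Fin k → EuclideanSpace ℝ (Fin n)) : Prop :=
  ∃ r : ℝ, 0 < r ∧ ∀ x, ∃ m, r * ‖x‖ ≤ inner ℝ (a m) x

theorem IsCoercive.isCompact {a : Fin k → EuclideanSpace ℝ (Fin n)} (h : IsCoercive a) :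
    IsCompact (polyhedron a) := by
  obtain ⟨r, hr, h⟩ := h
  refine Metric.isCompact_of_isClosed_isBounded (isClosed_polyhedron a)
    (isBounded_iff_forall_norm_le.2 ⟨1 / r, fun x hx => ?_⟩)
  obtain ⟨m, hm⟩ := h x
  rw [le_div_iff₀ hr, mul_comm]
  exact hm.trans (hx m)

/-- An extreme point is determined by its tight inequalities: if they are also tight at `y`, then
`x` is the midpoint of `x ± s (y - x)` inside the polyhedron. -/
theorem finite_extremePoints_polyhedron (a : Fin k → EuclideanSpace ℝ (Fin n)) :
    ((polyhedron a).extremePoints ℝ).Finite := by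
  refine Set.Finite.of_finite_image (f := fun x => {m | inner ℝ (a m) x = 1})
    (Set.toFinite _) ?_
  intro x hx y hy hxy
  have hI : ∀ m, inner ℝ (a m) x = 1 → inner ℝ (a m) y = 1 := fun m hm => by
    have : m ∈ {m | inner ℝ (a m) x = 1} := hm
    rw [show {m | inner ℝ (a m) x = 1} = {m | inner ℝ (a m) y = 1} from hxy] at this
    exact this
  obtain ⟨s, hs, h1, h2⟩ := exists_pos_add_smul_mem_polyhedron (a := a) (x := x) (w := y - x)
    fun m => by
      rcases lt_or_eq_of_le (hx.1 m) with h | h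
      · exact Or.inl h
      · exact Or.inr ⟨h, by rw [inner_sub_right, h, hI m h, sub_self]⟩
  have hseg : x ∈ openSegment ℝ (x + s • (y - x)) (x - s • (y - x)) :=
    ⟨1 / 2, 1 / 2, by norm_num, by norm_num, by norm_num, by module⟩
  have := hx.2 h1 h2 hseg
  have h3 : s • (y - x) = 0 := by simpa using this
  rcases smul_eq_zero.1 h3 with h4 | h4
  · exact absurd h4 hs.ne'
  · exact (sub_eq_zero.1 h4).symm

theorem IsCoercive.isPolytope {a : Fin k → EuclideanSpace ℝ (Fin n)} (h : IsCoercive a) :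
    IsPolytope (polyhedron a) := by
  have hfin := finite_extremePoints_polyhedron a
  refine ⟨hfin.toFinset, ?_⟩
  rw [hfin.coe_toFinset, ← (hfin.isClosed_convexHull ℝ).closure_eq]
  exact (closure_convexHull_extremePoints h.isCompact (convex_polyhedron a)).symm

theorem IsCoercive.isKPolytope {a : Fin k → EuclideanSpace ℝ (Fin n)} (h : IsCoercive a) {r : ℕ}
    (h' : IsNeighborly r a) : IsKPolytope n (polyhedron a) :=
  ⟨h.isPolytope, ⟨0, zero_mem_polyhedron a⟩, h'.affDim_polyhedron⟩

theorem closedOptCone_subset (P F : Set (EuclideanSpace ℝ (Fin n))) :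
    closedOptCone P F ⊆ (vectorSpan ℝ F)ᗮ := by
  rintro c ⟨F', -, hFF', δ, hd⟩
  refine mem_orthogonal_vectorSpan.2 fun x hx y hy => ?_
  have hx' := hFF' hx
  have hy' := hFF' hy
  rw [hd.2] at hx' hy'
  rw [hx'.2, hy'.2]

/-- Reduces the admissibility condition on `V` to disjointness from the normal space of `F`. -/
theorem affineSpan_closedOptCone_subset (P F : Set (EuclideanSpace ℝ (Fin n))) :
    (affineSpan ℝ (closedOptCone P F) : Set (EuclideanSpace ℝ (Fin n))) ⊆
      ((vectorSpan ℝ F)ᗮ : Submodule ℝ _) := by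
  have : affineSpan ℝ (closedOptCone P F) ≤ (vectorSpan ℝ F)ᗮ.toAffineSubspace :=
    affineSpan_le.2 (closedOptCone_subset P F)
  exact this

theorem zero_mem_closedOptCone {P F : Set (EuclideanSpace ℝ (Fin n))} (hF : IsFace P F) :
    (0 : EuclideanSpace ℝ (Fin n)) ∈ closedOptCone P F := by
  obtain ⟨hne, c, δ, hd⟩ := hF
  have hFP : F ⊆ P := by rw [hd.2]; exact Set.inter_subset_left
  have h0 : Defines (0 : EuclideanSpace ℝ (Fin n)) 0 P P :=
    ⟨fun x _ => by simp, by ext x; simp⟩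
  exact ⟨P, ⟨hne.mono hFP, 0, 0, h0⟩, hFP, 0, h0⟩

end Faces

end CayleyConstruction

namespace CayleyConstruction

/-! ### Faces and dimension of the Cayley embedding -/

section Cayley

variable {n : ℕ}

@[simp]
theorem lift_castSucc (α : ℝ) (x : EuclideanSpace ℝ (Fin n)) (i : Fin n) :
    lift α x i.castSucc = x i := by simp [lift]

@[simp]
theorem lift_last (α : ℝ) (x : EuclideanSpace ℝ (Fin n)) :
    lift α x (Fin.last n) = α := by simp [lift]

theorem inner_lift (α β : ℝ) (x y : EuclideanSpace ℝ (Fin n)) :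
    inner ℝ (lift α x) (lift β y) = inner ℝ x y + α * β := by
  simp only [PiLp.inner_apply, Fin.sum_univ_castSucc, lift_castSucc, lift_last]
  simp [mul_comm]

theorem exists_eq_lift (z : EuclideanSpace ℝ (Fin (n + 1))) :
    ∃ (α : ℝ) (x : EuclideanSpace ℝ (Fin n)), z = lift α x := by
  refine ⟨z (Fin.last n), WithLp.toLp 2 fun i => z i.castSucc, ?_⟩
  ext i
  refine Fin.lastCases ?_ (fun j => ?_) i <;> simp

theorem lift_add (α β : ℝ) (x y : EuclideanSpace ℝ (Fin n)) :
    lift (α + β) (x + y) = lift α x + lift β y := by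
  ext i
  refine Fin.lastCases ?_ (fun j => ?_) i <;> simp

theorem lift_smul (s α : ℝ) (x : EuclideanSpace ℝ (Fin n)) :
    lift (s * α) (s • x) = s • lift α x := by
  ext i
  refine Fin.lastCases ?_ (fun j => ?_) i <;> simp

theorem lift_inj {α β : ℝ} {x y : EuclideanSpace ℝ (Fin n)} :
    lift α x = lift β y ↔ α = β ∧ x = y := by
  refine ⟨fun h => ⟨by simpa using congrArg (fun z => z (Fin.last n)) h, ?_⟩,
    fun ⟨h, h'⟩ => by rw [h, h']⟩
  ext i
  simpa using congrArg (fun z => z i.castSucc) h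

/-- `lift α` as an affine map. -/
def liftAffine (α : ℝ) : EuclideanSpace ℝ (Fin n) →ᵃ[ℝ] EuclideanSpace ℝ (Fin (n + 1)) where
  toFun := lift α
  linear :=
    { toFun := lift 0
      map_add' := fun x y => by rw [← lift_add, add_zero]
      map_smul' := fun s x => by simp [← lift_smul] }
  map_vadd' p v := by
    change lift α (v + p) = lift 0 v + lift α p
    rw [← lift_add, zero_add]

theorem image_lift_convexHull (α : ℝ) (S : Set (EuclideanSpace ℝ (Fin n))) :
    lift α '' convexHull ℝ S = convexHull ℝ (lift α '' S) :=
  (liftAffine α).image_convexHull S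

theorem Convex.image_lift {P : Set (EuclideanSpace ℝ (Fin n))} (hP : Convex ℝ P) (α : ℝ) :
    Convex ℝ (lift α '' P) :=
  hP.affine_image (liftAffine α)

theorem IsPolytope.cayley {P Q : Set (EuclideanSpace ℝ (Fin n))} (hP : IsPolytope P)
    (hQ : IsPolytope Q) : IsPolytope (cayley P Q) := by
  classical
  obtain ⟨s, rfl⟩ := hP
  obtain ⟨t, rfl⟩ := hQ
  refine ⟨s.image (lift 0) ∪ t.image (lift 1), ?_⟩
  rw [CayleyConstruction.cayley, image_lift_convexHull, image_lift_convexHull,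
    convexHull_convexHull_union_left, convexHull_convexHull_union_right]
  simp

theorem lift_zero_mem_cayley {P : Set (EuclideanSpace ℝ (Fin n))}
    (Q : Set (EuclideanSpace ℝ (Fin n))) {x : EuclideanSpace ℝ (Fin n)} (hx : x ∈ P) :
    lift 0 x ∈ cayley P Q :=
  subset_convexHull ℝ _ (Or.inl ⟨x, hx, rfl⟩)

theorem mem_cayley {P Q : Set (EuclideanSpace ℝ (Fin n))} (hP : Convex ℝ P) (hQ : Convex ℝ Q)
    (hP' : P.Nonempty) (hQ' : Q.Nonempty) {z : EuclideanSpace ℝ (Fin (n + 1))} :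
    z ∈ cayley P Q ↔ ∃ x ∈ P, ∃ y ∈ Q, ∃ s t : ℝ, 0 ≤ s ∧ 0 ≤ t ∧ s + t = 1 ∧
      z = lift t (s • x + t • y) := by
  have key : ∀ (s t : ℝ) (x y : EuclideanSpace ℝ (Fin n)),
      s • lift 0 x + t • lift 1 y = lift t (s • x + t • y) := fun s t x y => by
    rw [← lift_smul, ← lift_smul, ← lift_add]; simp
  rw [cayley, convexHull_union (hP'.image _) (hQ'.image _),
    (Convex.image_lift hP 0).convexHull_eq, (Convex.image_lift hQ 1).convexHull_eq, mem_convexJoin]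
  constructor
  · rintro ⟨_, ⟨x, hx, rfl⟩, _, ⟨y, hy, rfl⟩, s, t, hs, ht, hst, rfl⟩
    exact ⟨x, hx, y, hy, s, t, hs, ht, hst, key s t x y⟩
  · rintro ⟨x, hx, y, hy, s, t, hs, ht, hst, rfl⟩
    exact ⟨_, ⟨x, hx, rfl⟩, _, ⟨y, hy, rfl⟩, s, t, hs, ht, hst, key s t x y⟩

theorem lift_zero_mem_cayley_iff {P Q : Set (EuclideanSpace ℝ (Fin n))} (hP : Convex ℝ P)
    (hQ : Convex ℝ Q) (hP' : P.Nonempty) (hQ' : Q.Nonempty) {x : EuclideanSpace ℝ (Fin n)} :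
    lift 0 x ∈ cayley P Q ↔ x ∈ P := by
  refine ⟨fun h => ?_, lift_zero_mem_cayley Q⟩
  obtain ⟨x', hx', y, hy, s, t, hs, ht, hst, e⟩ := (mem_cayley hP hQ hP' hQ').1 h
  obtain ⟨rfl, rfl⟩ := lift_inj.1 e
  obtain rfl : s = 1 := by linarith
  simpa using hx'

theorem Defines.cayley {c : EuclideanSpace ℝ (Fin n)} {δ : ℝ}
    {P Q F G : Set (EuclideanSpace ℝ (Fin n))} (hP : Convex ℝ P) (hQ : Convex ℝ Q)
    (h : Defines c δ P F) (h' : Defines c δ Q G) (hF : F.Nonempty) (hG : G.Nonempty) :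
    Defines (lift 0 c) δ (cayley P Q) (cayley F G) := by
  have hFP : F ⊆ P := by rw [h.2]; exact Set.inter_subset_left
  have hGQ : G ⊆ Q := by rw [h'.2]; exact Set.inter_subset_left
  have hmemF : ∀ x, x ∈ F ↔ x ∈ P ∧ inner ℝ c x = δ := fun x => by rw [h.2]; rfl
  have hmemG : ∀ x, x ∈ G ↔ x ∈ Q ∧ inner ℝ c x = δ := fun x => by rw [h'.2]; rfl
  have hinner : ∀ (s t : ℝ) (x y : EuclideanSpace ℝ (Fin n)),
      inner ℝ (lift 0 c) (lift t (s • x + t • y)) = s * inner ℝ c x + t * inner ℝ c y :=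
    fun s t x y => by
      rw [inner_lift, inner_add_right, inner_smul_right, inner_smul_right, zero_mul, add_zero]
  constructor
  · intro z hz
    obtain ⟨x, hx, y, hy, s, t, hs, ht, hst, rfl⟩ :=
      (mem_cayley hP hQ (hF.mono hFP) (hG.mono hGQ)).1 hz
    have h1 : inner ℝ c x ≤ δ := h.1 hx
    have h2 : inner ℝ c y ≤ δ := h'.1 hy
    simp only [Set.mem_ofPred_eq, hinner]
    calc s * inner ℝ c x + t * inner ℝ c y ≤ s * δ + t * δ := by gcongr
      _ = δ := by rw [← add_mul, hst, one_mul]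
  · ext z
    rw [Set.mem_inter_iff, mem_cayley (h.convex hP) (h'.convex hQ) hF hG,
      mem_cayley hP hQ (hF.mono hFP) (hG.mono hGQ)]
    constructor
    · rintro ⟨x, hx, y, hy, s, t, hs, ht, hst, rfl⟩
      refine ⟨⟨x, hFP hx, y, hGQ hy, s, t, hs, ht, hst, rfl⟩, ?_⟩
      simp only [Set.mem_ofPred_eq, hinner]
      rw [((hmemF x).1 hx).2, ((hmemG y).1 hy).2, ← add_mul, hst, one_mul]
    · rintro ⟨⟨x, hx, y, hy, s, t, hs, ht, hst, rfl⟩, hz⟩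
      simp only [Set.mem_ofPred_eq, hinner] at hz
      have h1 : inner ℝ c x ≤ δ := h.1 hx
      have h2 : inner ℝ c y ≤ δ := h'.1 hy
      have e0 : s * (δ - inner ℝ c x) + t * (δ - inner ℝ c y) = 0 := by
        have : s * δ + t * δ = δ := by rw [← add_mul, hst, one_mul]
        linarith
      have p1 := mul_nonneg hs (sub_nonneg.2 h1)
      have p2 := mul_nonneg ht (sub_nonneg.2 h2)
      have e1 : s * (δ - inner ℝ c x) = 0 := by linarith
      have e2 : t * (δ - inner ℝ c y) = 0 := by linarith
      -- If the weight `s` vanishes, `x` need not lie in `F`, but it can be replaced by any point of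
      -- `F`.
      obtain ⟨x', hx', ex⟩ : ∃ x' ∈ F, s • x' = s • x := by
        rcases mul_eq_zero.1 e1 with rfl | e
        · exact ⟨hF.some, hF.some_mem, by simp⟩
        · exact ⟨x, (hmemF x).2 ⟨hx, by linarith⟩, rfl⟩
      obtain ⟨y', hy', ey⟩ : ∃ y' ∈ G, t • y' = t • y := by
        rcases mul_eq_zero.1 e2 with rfl | e
        · exact ⟨hG.some, hG.some_mem, by simp⟩
        · exact ⟨y, (hmemG y).2 ⟨hy, by linarith⟩, rfl⟩
      exact ⟨x', hx', y', hy', s, t, hs, ht, hst, by rw [ex, ey]⟩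

theorem affDim_cayley {F G : Set (EuclideanSpace ℝ (Fin n))} (hF : F.Nonempty)
    (hG : G.Nonempty) :
    affDim (cayley F G) + finrank ℝ ((vectorSpan ℝ F)ᗮ ⊓ (vectorSpan ℝ G)ᗮ : Submodule ℝ _) =
      n + 1 := by
  obtain ⟨x₀, hx₀⟩ := hF
  obtain ⟨y₀, hy₀⟩ := hG
  -- A normal `(w, β)` must take equal values at `(x₀, 0)` and `(y₀, 1)`, which forces this last
  -- coordinate.
  let φ : EuclideanSpace ℝ (Fin n) →ₗ[ℝ] EuclideanSpace ℝ (Fin (n + 1)) :=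
    { toFun := fun w => lift (inner ℝ w (x₀ - y₀)) w
      map_add' := fun w w' => by rw [inner_add_left, lift_add]
      map_smul' := fun s w => by
        rw [inner_smul_left, RingHom.id_apply, ← lift_smul]; rfl }
  have hφ : Function.Injective φ := fun w w' h => (lift_inj.1 h).2
  have hdir : vectorSpan ℝ (cayley F G) = vectorSpan ℝ (lift 0 '' F ∪ lift 1 '' G) := by
    rw [← direction_affineSpan, cayley, affineSpan_convexHull, direction_affineSpan]
  have himage : (vectorSpan ℝ (cayley F G))ᗮ =
      ((vectorSpan ℝ F)ᗮ ⊓ (vectorSpan ℝ G)ᗮ : Submodule ℝ _).map φ := by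
    rw [hdir]
    ext z
    constructor
    · intro hz
      obtain ⟨β, w, rfl⟩ := exists_eq_lift z
      rw [mem_orthogonal_vectorSpan] at hz
      have hxx : ∀ x ∈ F, ∀ x' ∈ F, inner ℝ w x = inner ℝ w x' := fun x hx x' hx' => by
        simpa [inner_lift] using
          hz _ (Or.inl (Set.mem_image_of_mem _ hx)) _ (Or.inl (Set.mem_image_of_mem _ hx'))
      have hyy : ∀ y ∈ G, ∀ y' ∈ G, inner ℝ w y = inner ℝ w y' := fun y hy y' hy' => by
        simpa [inner_lift] using
          hz _ (Or.inr (Set.mem_image_of_mem _ hy)) _ (Or.inr (Set.mem_image_of_mem _ hy'))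
      have hxy : inner ℝ w x₀ = inner ℝ w y₀ + β := by
        simpa [inner_lift] using
          hz _ (Or.inl (Set.mem_image_of_mem _ hx₀)) _ (Or.inr (Set.mem_image_of_mem _ hy₀))
      refine ⟨w, ⟨mem_orthogonal_vectorSpan.2 hxx, mem_orthogonal_vectorSpan.2 hyy⟩, ?_⟩
      change lift (inner ℝ w (x₀ - y₀)) w = lift β w
      rw [inner_sub_right, hxy, add_sub_cancel_left]
    · rintro ⟨w, ⟨hw, hw'⟩, rfl⟩
      have hw := mem_orthogonal_vectorSpan.1 hw
      have hw' := mem_orthogonal_vectorSpan.1 hw'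
      rw [mem_orthogonal_vectorSpan]
      have key : ∀ z ∈ lift 0 '' F ∪ lift 1 '' G, inner ℝ (φ w) z = inner ℝ w x₀ := by
        rintro _ (⟨x, hx, rfl⟩ | ⟨y, hy, rfl⟩)
        · change inner ℝ (lift _ w) _ = _
          rw [inner_lift, hw x hx x₀ hx₀]; ring
        · change inner ℝ (lift _ w) _ = _
          rw [inner_lift, hw' y hy y₀ hy₀, inner_sub_right]; ring
      intro x hx y hy
      rw [key x hx, key y hy]
  rw [(Submodule.equivMapOfInjective φ hφ _).finrank_eq, ← himage,
    affDim_add_finrank_orthogonal]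

/-- A convex combination attains the maximum `δ` only if every point of nonzero weight does. -/
theorem Defines.eq_convexHull {s : Set (EuclideanSpace ℝ (Fin n))}
    {c : EuclideanSpace ℝ (Fin n)} {δ : ℝ} {F : Set (EuclideanSpace ℝ (Fin n))}
    (h : Defines c δ (convexHull ℝ s) F) : F = convexHull ℝ (s ∩ F) := by
  apply subset_antisymm
  · intro x hx
    have hx' := hx
    rw [h.2] at hx'
    obtain ⟨hx1, hx2⟩ := hx'
    rw [mem_convexHull_iff_exists_fintype] at hx1
    obtain ⟨ι, _, w, z, hw, hw1, hz, rfl⟩ := hx1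
    have hzle : ∀ i, inner ℝ c (z i) ≤ δ := fun i => h.1 (subset_convexHull ℝ _ (hz i))
    have hsum : ∑ i, w i * inner ℝ c (z i) = ∑ i, w i * δ := by
      rw [← Finset.sum_mul, hw1, one_mul]
      simpa [inner_sum, inner_smul_right] using hx2
    have heq := (Finset.sum_eq_sum_iff_of_le fun i _ =>
      mul_le_mul_of_nonneg_left (hzle i) (hw i)).1 hsum
    rw [← Fintype.sum_subset (s := {i | w i ≠ 0})
      fun i hi => Finset.mem_filter.2 ⟨Finset.mem_univ _, left_ne_zero_of_smul hi⟩]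
    refine (convex_convexHull ℝ _).sum_mem (fun i _ => hw i) (by rwa [Finset.sum_filter_ne_zero])
      fun i hi => subset_convexHull ℝ _ ⟨hz i, ?_⟩
    rw [h.2]
    exact ⟨subset_convexHull ℝ _ (hz i),
      mul_left_cancel₀ (Finset.mem_filter.1 hi).2 (heq i (Finset.mem_univ i))⟩
  · exact convexHull_min Set.inter_subset_right (h.convex (convex_convexHull ℝ s))

/-- Needed for the lower bound on the number of facets, since `Set.ncard` of an infinite set is `0`.
-/
theorem IsPolytope.finite_facets {P : Set (EuclideanSpace ℝ (Fin n))} (hP : IsPolytope P) :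
    (facets P).Finite := by
  obtain ⟨s, rfl⟩ := hP
  refine (s.finite_toSet.finite_subsets.image (convexHull ℝ)).subset ?_
  rintro F ⟨⟨-, c, δ, hd⟩, -⟩
  exact ⟨_, Set.inter_subset_left, hd.eq_convexHull.symm⟩

end Cayley

end CayleyConstruction

namespace CayleyConstruction

/-! ### Stability under small changes of the normals -/

section Perturbation

variable {n k : ℕ}

theorem HasExactPoint.eventually {a : Fin k → EuclideanSpace ℝ (Fin n)} {S : Finset (Fin k)}
    (h : HasExactPoint a S) (hli : LinearIndepOn ℝ a (S : Set (Fin k))) :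
    ∀ᶠ b in 𝓝 a, HasExactPoint b S := by
  classical
  obtain ⟨x, hx, hx'⟩ := h
  let M : (Fin k → EuclideanSpace ℝ (Fin n)) → Matrix S S ℝ :=
    fun b => Matrix.of fun s s' => inner ℝ (b s) (a s')
  let r : (Fin k → EuclideanSpace ℝ (Fin n)) → S → ℝ := fun b s => 1 - inner ℝ (b s) x
  -- Cramer's rule for the equations `⟨b s, X⟩ = 1`, solved in `x` plus the span of the `a s`. At `b
  -- = a` the matrix is the Gram matrix of independent vectors, so `X` is continuous there, with
  -- value `x`.
  let X : (Fin k → EuclideanSpace ℝ (Fin n)) → EuclideanSpace ℝ (Fin n) := fun b =>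
    x + (M b).det⁻¹ • ∑ s : S, ((M b).adjugate.mulVec (r b)) s • a s
  have hM : Continuous M := by
    refine continuous_matrix fun i j => ?_
    simp only [M, Matrix.of_apply]
    fun_prop
  have hr : Continuous r := by
    refine continuous_pi fun s => ?_
    simp only [r]
    fun_prop
  have hdet : (M a).det ≠ 0 := by
    have : (Matrix.gram ℝ fun s : S => a s).PosDef := Matrix.posDef_gram_of_linearIndependent hli
    exact this.det_pos.ne'
  have hra : r a = 0 := funext fun s => by simp [r, hx s s.2]
  have hXa : X a = x := by simp [X, hra]
  have hX : ContinuousAt X a := by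
    refine continuousAt_const.add ((hM.matrix_det.continuousAt.inv₀ hdet).smul ?_)
    refine Continuous.continuousAt (continuous_finsetSum _ fun s _ => ?_)
    exact ((continuous_apply s).comp (hM.matrix_adjugate.matrix_mulVec hr)).smul continuous_const
  have hdet' : ∀ᶠ b in 𝓝 a, (M b).det ≠ 0 := hM.matrix_det.continuousAt.eventually_ne hdet
  have hlt : ∀ᶠ b in 𝓝 a, ∀ m, m ∉ S → inner ℝ (b m) (X b) < 1 := by
    refine eventually_all.2 fun m => ?_
    by_cases hm : m ∈ S
    · exact Eventually.of_forall fun _ hm' => absurd hm hm'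
    · have hc : ContinuousAt (fun b : Fin k → EuclideanSpace ℝ (Fin n) => inner ℝ (b m) (X b)) a :=
        (continuous_apply m).continuousAt.inner hX
      have : ∀ᶠ b in 𝓝 a, inner ℝ (b m) (X b) < 1 :=
        hc.eventually_lt continuousAt_const (by simpa [hXa] using hx' m hm)
      exact this.mono fun _ h _ => h
  filter_upwards [hdet', hlt] with b hb hb'
  refine ⟨X b, fun m hm => ?_, hb'⟩
  have e : ∑ s : S, ((M b).adjugate.mulVec (r b)) s * inner ℝ (b m) (a s) =
      (M b).det * r b ⟨m, hm⟩ := by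
    have e1 : (M b).mulVec ((M b).adjugate.mulVec (r b)) = (M b).det • r b := by
      rw [Matrix.mulVec_mulVec, Matrix.mul_adjugate, Matrix.smul_mulVec, Matrix.one_mulVec]
    have := congrFun e1 ⟨m, hm⟩
    rw [Pi.smul_apply, smul_eq_mul] at this
    rw [← this]
    simp [Matrix.mulVec, dotProduct, M, mul_comm]
  simp only [X]
  rw [inner_add_right, inner_smul_right, inner_sum]
  simp only [inner_smul_right]
  rw [e, inv_mul_cancel_left₀ hb]
  simp [r]

theorem IsNeighborly.eventually {r : ℕ} {a : Fin k → EuclideanSpace ℝ (Fin n)}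
    (h : IsNeighborly r a) : ∀ᶠ b in 𝓝 a, IsNeighborly r b := by
  refine eventually_all.2 fun S => ?_
  by_cases hS : S.card ≤ r
  · exact ((h S hS).eventually (h.linearIndependent hS)).mono fun _ hb _ => hb
  · exact Eventually.of_forall fun _ h' => absurd h' hS

theorem IsCoercive.eventually {a : Fin k → EuclideanSpace ℝ (Fin n)} (h : IsCoercive a) :
    ∀ᶠ b in 𝓝 a, IsCoercive b := by
  obtain ⟨r, hr, h⟩ := h
  have : ∀ᶠ b in 𝓝 a, dist b a < r / 2 := Metric.ball_mem_nhds a (half_pos hr)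
  filter_upwards [this] with b hb
  refine ⟨r / 2, half_pos hr, fun x => ?_⟩
  obtain ⟨m, hm⟩ := h x
  refine ⟨m, ?_⟩
  have h1 : ‖a m - b m‖ ≤ r / 2 := by
    rw [← dist_eq_norm, dist_comm]
    exact (dist_le_pi_dist b a m).trans hb.le
  have h2 : inner ℝ (a m - b m) x ≤ r / 2 * ‖x‖ :=
    (real_inner_le_norm _ _).trans (by gcongr)
  rw [inner_sub_left] at h2
  linarith

end Perturbation

/-! ### Cyclic polytopes and their polars -/

section Cyclic

open Polynomial

variable {d k : ℕ}

/-- The coefficients of `p` at the positive powers up to `d`. -/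
def coeffVector (d : ℕ) (p : ℝ[X]) : EuclideanSpace ℝ (Fin d) :=
  WithLp.toLp 2 fun i : Fin d => p.coeff ((i : ℕ) + 1)

theorem eval_eq_coeff_add_inner {p : ℝ[X]} (hp : p.natDegree ≤ d) (t : ℝ) :
    p.eval t = p.coeff 0 + inner ℝ (coeffVector d p) (momentCurve d t) := by
  rw [eval_eq_sum_range' (Nat.lt_succ_of_le hp), Finset.sum_range_succ', add_comm]
  congr 1
  · simp
  · simp only [PiLp.inner_apply, coeffVector, momentCurve]
    rw [← Fin.sum_univ_eq_sum_range (fun i => p.coeff (i + 1) * t ^ (i + 1)) d]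
    simp [mul_comm]

/-- A hyperplane containing all the points would give a nonzero polynomial of degree at most `d`
with `k > d` roots. -/
theorem interior_cyclicPolytope_nonempty (hk : d < k) {t : Fin k → ℝ}
    (ht : Function.Injective t) : (interior (cyclicPolytope d t)).Nonempty := by
  rw [cyclicPolytope, interior_convexHull_nonempty_iff_affineSpan_eq_top]
  have hne : (Set.range fun m => momentCurve d (t m)).Nonempty :=
    ⟨_, ⟨0, Nat.zero_lt_of_lt hk⟩, rfl⟩
  rw [← AffineSubspace.direction_eq_top_iff_of_nonempty ((affineSpan_nonempty ℝ).2 hne),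
    direction_affineSpan, ← Submodule.orthogonal_eq_bot_iff, Submodule.eq_bot_iff]
  intro w hw
  rw [mem_orthogonal_vectorSpan] at hw
  let m₀ : Fin k := ⟨0, Nat.zero_lt_of_lt hk⟩
  let p : ℝ[X] := ∑ i : Fin d, C (w i) * X ^ ((i : ℕ) + 1) - C (inner ℝ w (momentCurve d (t m₀)))
  have hp : p.natDegree ≤ d := by
    refine (natDegree_sub_le _ _).trans (max_le (natDegree_sum_le_of_forall_le _ _ fun i _ => ?_)
      ((natDegree_C _).trans_le (Nat.zero_le d)))
    exact (natDegree_C_mul_X_pow_le _ _).trans i.2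
  have hzero : p = 0 := by
    refine eq_zero_of_natDegree_lt_card_of_eval_eq_zero p ht (fun m => ?_)
      (by simpa using hp.trans_lt hk)
    have := hw _ ⟨m, rfl⟩ _ ⟨m₀, rfl⟩
    simp only [p, eval_sub, eval_finsetSum, eval_mul, eval_C, eval_pow, eval_X, ← this]
    simp [PiLp.inner_apply, momentCurve, mul_comm]
  ext i
  have := congrArg (fun q => q.coeff ((i : ℕ) + 1)) hzero
  simpa [p, finsetSum_coeff, coeff_C, coeff_X_pow, Fin.val_inj] using this

/-- A small step from `v` away from `x` stays in `C`, so `v` is a convex combination of a point with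
nonnegative value and, with positive weight, of `x`. -/
theorem pos_of_mem_interior_of_nonneg {C : Set (EuclideanSpace ℝ (Fin d))}
    {v x q : EuclideanSpace ℝ (Fin d)} {α : ℝ} (hv : v ∈ interior C)
    (hC : ∀ y ∈ C, 0 ≤ α + inner ℝ q y) (hx : 0 < α + inner ℝ q x) : 0 < α + inner ℝ q v := by
  have hc : Continuous fun s : ℝ => v - s • (x - v) := by fun_prop
  have h1 : ∀ᶠ s : ℝ in 𝓝 0, v - s • (x - v) ∈ C :=
    hc.continuousAt.preimage_mem_nhds (by simpa using mem_interior_iff_mem_nhds.1 hv)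
  obtain ⟨s, hsC, hs⟩ := ((h1.filter_mono nhdsWithin_le_nhds).and
      (self_mem_nhdsWithin (s := Set.Ioi (0 : ℝ)))).exists
  have hs : 0 < s := hs
  have h2 := hC _ hsC
  rw [inner_sub_right, inner_smul_right, inner_sub_right] at h2
  have h3 := mul_pos hs hx
  have h4 : 0 < (1 + s) * (α + inner ℝ q v) := by linarith
  exact pos_of_mul_pos_right h4 (by linarith)

theorem isNeighborly_normals {r : ℕ} (hr : 2 * r ≤ d) (hk : r < k) {t : Fin k → ℝ}
    (ht : Function.Injective t) {v : EuclideanSpace ℝ (Fin d)}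
    (hv : v ∈ interior (cyclicPolytope d t)) : IsNeighborly r (normals d t v) := by
  intro S hS
  -- Nonnegative, and zero exactly at the parameters indexed by `S`.
  let p : ℝ[X] := ∏ s ∈ S, (X - C (t s)) ^ 2
  have hp : p.natDegree ≤ d := by
    refine (natDegree_prod_le _ _).trans (le_trans (Finset.sum_le_card_nsmul _ _ 2 fun s _ => ?_) ?_)
    · exact natDegree_pow_le.trans (by simp)
    · rw [smul_eq_mul]; omega
  have heval : ∀ x, p.eval x = ∏ s ∈ S, (x - t s) ^ 2 := fun x => by simp [p, eval_prod]
  have hnonneg : ∀ x, 0 ≤ p.eval x := fun x => by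
    rw [heval]; exact Finset.prod_nonneg fun s _ => sq_nonneg _
  have hzero : ∀ m ∈ S, p.eval (t m) = 0 := fun m hm => by
    rw [heval]; exact Finset.prod_eq_zero hm (by simp)
  have hpos : ∀ m ∉ S, 0 < p.eval (t m) := fun m hm => by
    rw [heval]
    exact Finset.prod_pos fun s hs => sq_pos_of_ne_zero (sub_ne_zero.2 fun e => hm (ht e ▸ hs))
  obtain ⟨m₀, hm₀⟩ : ∃ m₀, m₀ ∉ S := by
    by_contra! hall
    have : S = Finset.univ := Finset.eq_univ_of_forall hall
    rw [this] at hS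
    simp at hS
    omega
  set q := coeffVector d p with hq
  have hf : 0 < p.coeff 0 + inner ℝ q v := by
    refine pos_of_mem_interior_of_nonneg hv (x := momentCurve d (t m₀)) ?_ ?_
    · have hhull : cyclicPolytope d t ⊆ {y | -p.coeff 0 ≤ inner ℝ q y} := by
        refine convexHull_min ?_ (convex_halfSpace_ge (innerₗ _ q).isLinear _)
        rintro _ ⟨m, rfl⟩
        have := hnonneg (t m)
        rw [eval_eq_coeff_add_inner hp] at this
        change -p.coeff 0 ≤ inner ℝ q (momentCurve d (t m))
        linarith
      intro y hy
      have : -p.coeff 0 ≤ inner ℝ q y := hhull hy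
      linarith
    · rw [← eval_eq_coeff_add_inner hp]
      exact hpos m₀ hm₀
  set f := p.coeff 0 + inner ℝ q v with hf_def
  -- Dividing by `f`, the positive value at `v` of the supporting affine function, turns that
  -- function into a point of the polar.
  have hinner : ∀ m, inner ℝ (normals d t v m) (-f⁻¹ • q) = 1 - p.eval (t m) / f := fun m => by
    rw [normals, inner_smul_right, real_inner_comm, inner_sub_right,
      eval_eq_coeff_add_inner hp, ← hq]
    field_simp
    rw [hf_def]
    ring
  refine ⟨-f⁻¹ • q, fun m hm => ?_, fun m hm => ?_⟩
  · rw [hinner, hzero m hm]; simp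
  · rw [hinner]
    have := div_pos (hpos m hm) hf
    linarith

theorem isCoercive_normals {t : Fin k → ℝ} {v : EuclideanSpace ℝ (Fin d)}
    (hv : v ∈ interior (cyclicPolytope d t)) : IsCoercive (normals d t v) := by
  obtain ⟨ρ, hρ, hball⟩ := Metric.nhds_basis_closedBall.mem_iff.1 (mem_interior_iff_mem_nhds.1 hv)
  refine ⟨ρ, hρ, fun x => ?_⟩
  by_contra! hlt
  -- The point of the ball farthest in direction `x`; for `x = 0` the quotient is `0` and the point
  -- is `v`.
  have hmem : v + (ρ / ‖x‖) • x ∈ cyclicPolytope d t := by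
    apply hball
    rw [mem_closedBall_iff_norm, add_sub_cancel_left, norm_smul, Real.norm_eq_abs, abs_div,
      abs_of_pos hρ, abs_norm]
    rcases eq_or_ne x 0 with rfl | hx
    · simpa using hρ.le
    · rw [div_mul_cancel₀ _ (norm_ne_zero_iff.2 hx)]
  have hhull : cyclicPolytope d t ⊆ {y | inner ℝ x y < inner ℝ x v + ρ * ‖x‖} := by
    refine convexHull_min ?_ (convex_halfSpace_lt (innerₗ _ x).isLinear _)
    rintro _ ⟨m, rfl⟩
    have := hlt m
    rw [normals, real_inner_comm, inner_sub_right] at this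
    change inner ℝ x (momentCurve d (t m)) < _
    linarith
  have h1 : inner ℝ x (v + (ρ / ‖x‖) • x) < inner ℝ x v + ρ * ‖x‖ := hhull hmem
  rw [inner_add_right, inner_smul_right, real_inner_self_eq_norm_sq] at h1
  rcases eq_or_ne x 0 with rfl | hx
  · simp at h1
  · have : ρ / ‖x‖ * ‖x‖ ^ 2 = ρ * ‖x‖ := by
      have := norm_ne_zero_iff.2 hx
      field_simp
    linarith

theorem polarCyclic_eq_polyhedron (t : Fin k → ℝ) (v : EuclideanSpace ℝ (Fin d)) :
    polarCyclic d t v = polyhedron (normals d t v) := by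
  ext y
  constructor
  · intro hy m
    exact hy _ ⟨_, subset_convexHull ℝ _ ⟨m, rfl⟩, rfl⟩
  · rintro hy _ ⟨x, hx, rfl⟩
    have hhull : cyclicPolytope d t ⊆ {z | inner ℝ y z ≤ 1 + inner ℝ y v} := by
      refine convexHull_min ?_ (convex_halfSpace_le (innerₗ _ y).isLinear _)
      rintro _ ⟨m, rfl⟩
      have := hy m
      rw [normals, real_inner_comm, inner_sub_right] at this
      change inner ℝ y (momentCurve d (t m)) ≤ _
      linarith
    have : inner ℝ y x ≤ 1 + inner ℝ y v := hhull hx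
    change inner ℝ (x - v) y ≤ 1
    rw [real_inner_comm, inner_sub_right]
    linarith

end Cyclic

/-! ### Generic subspaces and small centered simplices -/

section Shifts

theorem exists_finrank_eq_forall_disjoint {E : Type*} [AddCommGroup E] [Module ℝ E]
    [FiniteDimensional ℝ E] (l : ℕ) (hl : l ≤ finrank ℝ E) (s : Finset (Submodule ℝ E))
    (hs : ∀ W ∈ s, finrank ℝ W + l ≤ finrank ℝ E) :
    ∃ V : Submodule ℝ E, finrank ℝ V = l ∧ ∀ W ∈ s, Disjoint V W := by
  classical
  induction l generalizing s with
  | zero => exact ⟨⊥, finrank_bot ℝ E, fun W _ => disjoint_bot_left⟩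
  | succ l ih =>
    -- Including `⊥` forces `v ≠ 0` and later makes `V` disjoint from the line of `v`, so that
    -- adding `v` raises the dimension.
    have hs' : ∀ W ∈ insert ⊥ s, finrank ℝ W + (l + 1) ≤ finrank ℝ E := fun W hW => by
      rcases Finset.mem_insert.1 hW with rfl | hW
      · simpa using hl
      · exact hs W hW
    -- Finitely many proper subspaces do not cover a real vector space.
    obtain ⟨v, hv⟩ : ∃ v : E, ∀ W ∈ insert ⊥ s, v ∉ W := by
      have := Subspace.biUnion_ne_univ_of_top_notMem (k := ℝ) (E := E) (s := insert ⊥ s)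
        fun htop => by
          have := hs' ⊤ htop
          rw [finrank_top] at this
          omega
      obtain ⟨v, hv⟩ := (Set.ne_univ_iff_exists_notMem _).1 this
      refine ⟨v, fun W hW hvW => hv ?_⟩
      simp only [Set.mem_iUnion]
      exact ⟨W, hW, hvW⟩
    have hv0 : v ≠ 0 := fun h => hv ⊥ (Finset.mem_insert_self _ _) (by simp [h])
    have hdisj : ∀ W ∈ insert ⊥ s, Disjoint (Submodule.span ℝ {v}) W := fun W hW =>
      (Submodule.disjoint_span_singleton' hv0).2 (hv W hW) |>.symm
    have hfr : ∀ W : Submodule ℝ E, Disjoint W (Submodule.span ℝ {v}) →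
        finrank ℝ (W ⊔ Submodule.span ℝ {v} : Submodule ℝ E) = finrank ℝ W + 1 := fun W hW => by
      have := Submodule.finrank_sup_add_finrank_inf_eq W (Submodule.span ℝ {v})
      rw [hW.eq_bot, finrank_bot, finrank_span_singleton hv0] at this
      simpa using this
    obtain ⟨V, hV, hVs⟩ := ih (Nat.le_of_succ_le hl)
      ((insert ⊥ s).image fun W => Submodule.span ℝ {v} ⊔ W) (fun W' hW' => by
        obtain ⟨W, hW, rfl⟩ := Finset.mem_image.1 hW'
        rw [sup_comm, hfr W (hdisj W hW).symm]
        have := hs' W hW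
        omega)
    have hVs' : ∀ W ∈ insert ⊥ s, Disjoint V (Submodule.span ℝ {v} ⊔ W) := fun W hW =>
      hVs _ (Finset.mem_image_of_mem _ hW)
    refine ⟨V ⊔ Submodule.span ℝ {v}, ?_, fun W hW => ?_⟩
    · rw [hfr V, hV]
      simpa using hVs' ⊥ (Finset.mem_insert_self _ _)
    · have hW' := Finset.mem_insert_of_mem (b := ⊥) hW
      exact (hdisj W hW').disjoint_sup_left_of_disjoint_sup_right (hVs' W hW')

theorem exists_small_centered_simplex {E : Type*} [NormedAddCommGroup E] [NormedSpace ℝ E]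
    [FiniteDimensional ℝ E] {l : ℕ} (hl : 0 < l) (V : Submodule ℝ E) (hV : finrank ℝ V = l)
    {ε : ℝ} (hε : 0 < ε) :
    ∃ u : Fin l → E, (∀ j, u j ∈ V) ∧ (∀ j, ‖u j‖ < ε) ∧ AffineIndependent ℝ u ∧
      ∑ j, u j = 0 ∧ (0 : E) ∈ intrinsicInterior ℝ (convexHull ℝ (Set.range u)) := by
  have hl' : (0 : ℝ) < l := Nat.cast_pos.2 hl
  let b : Basis (Fin l) ℝ V := finBasisOfFinrankEq ℝ V hV
  obtain ⟨g, hg⟩ := V.subtype.exists_leftInverse_of_injective (by simp)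
  let f : Fin l → E →ₗ[ℝ] ℝ := fun j => (b.coord j).comp g
  have hfb : ∀ i j, f j (b i) = if i = j then 1 else 0 := fun i j => by
    have : g (b i : E) = b i := congrFun (congrArg DFunLike.coe hg) (b i)
    simp [f, this, Finsupp.single_apply]
  -- Basis vectors recentered at their barycenter; only the zero sum makes the shifts cancel later.
  let e : Fin l → E := fun j => (b j : E) - (l : ℝ)⁻¹ • ∑ i, (b i : E)
  have hfe : ∀ i j, f j (e i) = (if i = j then 1 else 0) - (l : ℝ)⁻¹ := fun i j => by
    simp [e, hfb]
  have hesum : ∑ j, e j = 0 := by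
    simp only [e, Finset.sum_sub_distrib, Finset.sum_const, Finset.card_univ, Fintype.card_fin]
    rw [← Nat.cast_smul_eq_nsmul ℝ, smul_smul, mul_inv_cancel₀ hl'.ne', one_smul, sub_self]
  let δ : ℝ := ε / (∑ j, ‖e j‖ + 1)
  have hden : 0 < ∑ j, ‖e j‖ + 1 := by positivity
  have hδ : 0 < δ := div_pos hε hden
  let u : Fin l → E := fun j => δ • e j
  have hfu : ∀ i j, f j (u i) = δ * ((if i = j then 1 else 0) - (l : ℝ)⁻¹) := fun i j => by
    simp [u, hfe]
  have husum : ∑ j, u j = 0 := by simp only [u, ← Finset.smul_sum, hesum, smul_zero]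
  -- The functionals `f j` recover the weights: total weight `0` yields affine independence, and
  -- total weight `1` makes `w j > 0` equivalent to `f j > -δ / l`, an open condition that holds at
  -- `0`.
  have hfcomb : ∀ (s : Finset (Fin l)) (w : Fin l → ℝ) (j : Fin l), j ∈ s →
      f j (∑ i ∈ s, w i • u i) = δ * (w j - (l : ℝ)⁻¹ * ∑ i ∈ s, w i) := fun s w j hj => by
    simp only [map_sum, map_smul, hfu, smul_eq_mul]
    have : ∀ i ∈ s, w i * (δ * ((if i = j then 1 else 0) - (l : ℝ)⁻¹)) =
        (if i = j then δ * w i else 0) - δ * ((l : ℝ)⁻¹ * w i) := fun i _ => by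
      split_ifs <;> ring
    rw [Finset.sum_congr rfl this, Finset.sum_sub_distrib, Finset.sum_ite_eq' s j, if_pos hj,
      ← Finset.mul_sum, ← Finset.mul_sum, mul_sub]
  refine ⟨u, fun j => ?_, fun j => ?_, ?_, husum, ?_⟩
  · exact V.smul_mem _ (V.sub_mem (b j).2 (V.smul_mem _ (V.sum_mem fun i _ => (b i).2)))
  · rw [norm_smul, Real.norm_of_nonneg hδ.le, div_mul_eq_mul_div, div_lt_iff₀ hden]
    have := Finset.single_le_sum (fun i _ => norm_nonneg (e i)) (Finset.mem_univ j)
    exact mul_lt_mul_of_pos_left (by linarith) hε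
  · rw [affineIndependent_iff]
    intro s w hw hwu j hj
    have := hfcomb s w j hj
    rw [hwu, hw, map_zero, mul_zero, sub_zero] at this
    exact (mul_eq_zero.1 this.symm).resolve_left hδ.ne'
  · have h0 : (0 : E) ∈ convexHull ℝ (Set.range u) :=
      mem_convexHull_of_exists_fintype (fun _ => (l : ℝ)⁻¹) u (fun _ => by positivity)
        (by simp [hl'.ne']) (fun j => ⟨j, rfl⟩) (by rw [← Finset.smul_sum, husum, smul_zero])
    rw [mem_intrinsicInterior]
    refine ⟨⟨0, subset_affineSpan ℝ _ h0⟩, ?_, rfl⟩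
    rw [mem_interior_iff_mem_nhds]
    have hnear : ∀ᶠ y : affineSpan ℝ (convexHull ℝ (Set.range u)) in
        𝓝 ⟨0, subset_affineSpan ℝ _ h0⟩, ∀ j, -(δ * (l : ℝ)⁻¹) < f j y := by
      refine eventually_all.2 fun j => ?_
      have hc : Continuous fun y : affineSpan ℝ (convexHull ℝ (Set.range u)) => f j y :=
        (f j).continuous_of_finiteDimensional.comp continuous_subtype_val
      refine continuousAt_const.eventually_lt hc.continuousAt ?_
      have : 0 < δ * (l : ℝ)⁻¹ := by positivity
      simpa using this
    filter_upwards [hnear] with y hy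
    have hyspan : (y : E) ∈ affineSpan ℝ (Set.range u) := by
      exact (affineSpan_convexHull (𝕜 := ℝ) (Set.range u)).le y.2
    obtain ⟨w, hw, hyw⟩ := eq_affineCombination_of_mem_affineSpan_of_fintype hyspan
    rw [Finset.affineCombination_eq_linear_combination _ _ _ hw] at hyw
    refine mem_convexHull_of_exists_fintype w u (fun j => ?_) hw (fun j => ⟨j, rfl⟩) hyw.symm
    have h1 := hy j
    rw [hyw, hfcomb _ w j (Finset.mem_univ j), hw] at h1
    have h2 : 0 < δ * w j := by linarith
    exact (pos_of_mul_pos_right h2 hδ.le).le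

end Shifts

end CayleyConstruction

namespace CayleyConstruction

/-! ### Common normals and the choice of shifts -/

section Shifts

theorem span_inf_span_add_eq {E : Type*} [AddCommGroup E] [Module ℝ E] {l : ℕ} (hl : 0 < l)
    {a u : Fin l → E} {V : Submodule ℝ E} (hV : Disjoint V (Submodule.span ℝ (Set.range a)))
    (huV : ∀ j, u j ∈ V) (hu : AffineIndependent ℝ u) (hsum : ∑ j, u j = 0) :
    Submodule.span ℝ (Set.range a) ⊓ Submodule.span ℝ (Set.range (a + u)) =
      Submodule.span ℝ {∑ j, a j} := by
  have hl' : (l : ℝ) ≠ 0 := Nat.cast_ne_zero.2 hl.ne'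
  apply le_antisymm
  · rintro z ⟨hz, hz'⟩
    obtain ⟨ν, rfl⟩ := (Submodule.mem_span_range_iff_exists_fun ℝ).1 hz'
    have hz' : ∑ j, ν j • (a + u) j = ∑ j, ν j • a j + ∑ j, ν j • u j := by
      simp [Finset.sum_add_distrib]
    rw [hz'] at hz ⊢
    have hνa : ∑ j, ν j • a j ∈ Submodule.span ℝ (Set.range a) :=
      (Submodule.mem_span_range_iff_exists_fun ℝ).2 ⟨ν, rfl⟩
    have hνu : ∑ j, ν j • u j = 0 := by
      refine Submodule.disjoint_def.1 hV _ (V.sum_mem fun j _ => V.smul_mem _ (huV j)) ?_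
      exact (Submodule.add_mem_iff_right _ hνa).1 hz
    set q : ℝ := (l : ℝ)⁻¹ * ∑ i, ν i with hq
    -- Subtracting the mean makes the weights sum to `0` and, as `∑ u j = 0`, leaves the relation
    -- intact; affine independence applies.
    have hν : ∀ j, ν j = q := fun j => by
      have := (affineIndependent_iff.1 hu) Finset.univ (fun j => ν j - q)
        (by simp [hq, hl']) (by simp [sub_smul, hνu, ← Finset.smul_sum, hsum]) j (Finset.mem_univ j)
      exact sub_eq_zero.1 this
    rw [hνu, add_zero]
    simp only [hν, ← Finset.smul_sum]
    exact Submodule.smul_mem _ _ (Submodule.mem_span_singleton_self _)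
  · rw [Submodule.span_singleton_le_iff_mem]
    refine ⟨Submodule.sum_mem _ fun j _ => Submodule.subset_span ⟨j, rfl⟩, ?_⟩
    have : ∑ j, a j = ∑ j, (a + u) j := by simp [Finset.sum_add_distrib, hsum]
    rw [this]
    exact Submodule.sum_mem _ fun j _ => Submodule.subset_span ⟨j, rfl⟩

/-- Only finitely many subspaces are spanned by normals, so one `V` avoids all those of dimension
`d/2`. As `d` is even, these include the normal spaces of all `d/2`-faces. -/
theorem exists_admissible_shift {d k : ℕ} (hd : Even d) (hd2 : 2 ≤ d)
    (a : Fin k → EuclideanSpace ℝ (Fin d)) {ε : ℝ} (hε : 0 < ε) :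
    ∃ u : Fin (d / 2) → EuclideanSpace ℝ (Fin d), (∀ j, ‖u j‖ < ε) ∧
      IsAdmissibleShift (polyhedron a) u ∧ ∑ j, u j = 0 ∧
      ∃ V : Submodule ℝ (EuclideanSpace ℝ (Fin d)), (∀ j, u j ∈ V) ∧
        ∀ I : Set (Fin k), finrank ℝ (Submodule.span ℝ (a '' I)) = d / 2 →
          Disjoint V (Submodule.span ℝ (a '' I)) := by
  classical
  obtain ⟨l, rfl⟩ := hd
  have hfin : {W : Submodule ℝ (EuclideanSpace ℝ (Fin (l + l))) |
      finrank ℝ W = (l + l) / 2 ∧ ∃ I : Set (Fin k), Submodule.span ℝ (a '' I) = W}.Finite :=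
    (Set.finite_range fun I : Set (Fin k) => Submodule.span ℝ (a '' I)).subset fun W hW => hW.2
  obtain ⟨V, hVl, hV⟩ := exists_finrank_eq_forall_disjoint
    (E := EuclideanSpace ℝ (Fin (l + l))) ((l + l) / 2)
    (by rw [finrank_euclideanSpace_fin]; omega) hfin.toFinset (fun W hW => by
      rw [hfin.mem_toFinset] at hW
      rw [finrank_euclideanSpace_fin, hW.1]
      omega)
  have hV' : ∀ I : Set (Fin k), finrank ℝ (Submodule.span ℝ (a '' I)) = (l + l) / 2 →
      Disjoint V (Submodule.span ℝ (a '' I)) := fun I hI =>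
    hV _ (hfin.mem_toFinset.2 ⟨hI, I, rfl⟩)
  obtain ⟨u, huV, hnorm, hu, hsum, hint⟩ :=
    exists_small_centered_simplex (l := (l + l) / 2) (by omega) V hVl hε
  refine ⟨u, hnorm, ⟨⟨V, hVl, fun F hF => ?_, huV⟩, hu, hint⟩, hsum, V, huV, hV'⟩
  have hort := orthogonal_vectorSpan_of_isFace hF.1
  have hdisj : Disjoint V (vectorSpan ℝ F)ᗮ := by
    rw [hort]
    apply hV'
    have := affDim_add_finrank_orthogonal F
    rw [hF.2, hort] at this
    omega
  apply subset_antisymm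
  · rintro w ⟨hwV, hw⟩
    exact Submodule.disjoint_def.1 hdisj w hwV (affineSpan_closedOptCone_subset _ _ hw)
  · rintro _ rfl
    exact ⟨V.zero_mem, subset_affineSpan ℝ _ (zero_mem_closedOptCone hF.1)⟩

end Shifts

/-! ### Colorful faces and the facets they produce -/

section Selections

variable {n k l : ℕ}

theorem IsSelection.injective {κ : Fin k → Fin l} {i : Fin l → Fin k} (hi : IsSelection κ i) :
    Function.Injective i :=
  Function.LeftInverse.injective (g := κ) hi

theorem IsSelection.card_image {κ : Fin k → Fin l} {i : Fin l → Fin k} (hi : IsSelection κ i) :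
    (Finset.univ.image i).card = l := by
  rw [Finset.card_image_of_injective _ hi.injective, Finset.card_univ, Fintype.card_fin]

theorem tightSet_eq_tightFace (P : Set (EuclideanSpace ℝ (Fin n)))
    (a : Fin k → EuclideanSpace ℝ (Fin n)) (i : Fin l → Fin k) :
    tightSet P a i = tightFace P a (Finset.univ.image i) := by
  simp [tightSet, tightFace]

theorem IsNeighborly.isKFace_tightSet {a : Fin k → EuclideanSpace ℝ (Fin n)}
    (h : IsNeighborly l a) {κ : Fin k → Fin l} {i : Fin l → Fin k} (hi : IsSelection κ i) {m : ℕ}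
    (hm : m + l = n) : IsKFace m (polyhedron a) (tightSet (polyhedron a) a i) := by
  rw [tightSet_eq_tightFace]
  refine ⟨(h _ hi.card_image.le).isFace, ?_⟩
  have := h.affDim_tightFace hi.card_image.le
  rw [hi.card_image] at this
  omega

theorem defines_tightSet {a : Fin k → EuclideanSpace ℝ (Fin n)} {κ : Fin k → Fin l}
    {i : Fin l → Fin k} (hi : IsSelection κ i) :
    Defines (∑ j, a (i j)) l (polyhedron a) (tightSet (polyhedron a) a i) := by
  have := defines_tightFace a (Finset.univ.image i)
  rwa [hi.card_image, Finset.sum_image hi.injective.injOn, ← tightSet_eq_tightFace] at this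

theorem IsNeighborly.orthogonal_vectorSpan_tightSet {a : Fin k → EuclideanSpace ℝ (Fin n)}
    (h : IsNeighborly l a) {κ : Fin k → Fin l} {i : Fin l → Fin k} (hi : IsSelection κ i) :
    (vectorSpan ℝ (tightSet (polyhedron a) a i))ᗮ = Submodule.span ℝ (Set.range (a ∘ i)) := by
  rw [tightSet_eq_tightFace, h.orthogonal_vectorSpan hi.card_image.le]
  simp [Set.range_comp]

theorem IsNeighborly.linearIndependent_comp {a : Fin k → EuclideanSpace ℝ (Fin n)}
    (h : IsNeighborly l a) {κ : Fin k → Fin l} {i : Fin l → Fin k} (hi : IsSelection κ i) :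
    LinearIndependent ℝ (a ∘ i) := by
  have := h.linearIndependent hi.card_image.le
  rw [Finset.coe_image, Finset.coe_univ, Set.image_univ] at this
  exact (linearIndepOn_range_iff hi.injective a).1 this

/-- The face determines its set of tight indices, and the colors determine which index belongs to
which `j`. -/
theorem injOn_tightSet {a : Fin k → EuclideanSpace ℝ (Fin n)} (h : IsNeighborly l a)
    (κ : Fin k → Fin l) :
    Set.InjOn (fun i => tightSet (polyhedron a) a i) {i | IsSelection κ i} := by
  intro i hi i' hi' e
  have hi : IsSelection κ i := hi
  have hi' : IsSelection κ i' := hi'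
  simp only [tightSet_eq_tightFace] at e
  have e' := tightFace_injective h hi.card_image.le hi'.card_image.le e
  funext j
  have hmem : i j ∈ Finset.univ.image i' := e' ▸ Finset.mem_image_of_mem i (Finset.mem_univ j)
  obtain ⟨j', -, hj'⟩ := Finset.mem_image.1 hmem
  have : j' = j := by rw [← hi' j', hj', hi j]
  rw [← hj', this]

theorem ncard_isSelection {κ : Fin k → Fin l} {q : ℕ} (hκ : ∀ j, {m | κ m = j}.ncard = q) :
    {i | IsSelection κ i}.ncard = q ^ l := by
  classical
  have : {i | IsSelection κ i} =
      (Fintype.piFinset fun j => Finset.univ.filter fun m => κ m = j : Finset (Fin l → Fin k)) := by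
    ext i
    simp [IsSelection]
  rw [this, Set.ncard_coe_finset, Fintype.card_piFinset]
  have hcard : ∀ j, (Finset.univ.filter fun m => κ m = j).card = q := fun j => by
    rw [← hκ j, ← Set.ncard_coe_finset]
    simp
  simp [hcard]

section Shifted

variable {a : Fin k → EuclideanSpace ℝ (Fin n)} {κ : Fin k → Fin l}
  {u : Fin l → EuclideanSpace ℝ (Fin n)} {i : Fin l → Fin k}

theorem IsSelection.shiftedNormals_comp (hi : IsSelection κ i) :
    shiftedNormals a κ u ∘ i = a ∘ i + u := by
  funext j
  simp [shiftedNormals, hi j]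

theorem cayley_tightSet_mem_facets (hl : 0 < l) (ha : IsNeighborly l a)
    (hb : IsNeighborly l (shiftedNormals a κ u)) (hi : IsSelection κ i)
    {V : Submodule ℝ (EuclideanSpace ℝ (Fin n))}
    (hV : Disjoint V (Submodule.span ℝ (Set.range (a ∘ i)))) (huV : ∀ j, u j ∈ V)
    (hu : AffineIndependent ℝ u) (hsum : ∑ j, u j = 0) :
    cayley (tightSet (polyhedron a) a i)
        (tightSet (polyhedron (shiftedNormals a κ u)) (shiftedNormals a κ u) i) ∈
      facets (cayley (polyhedron a) (polyhedron (shiftedNormals a κ u))) := by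
  set b := shiftedNormals a κ u with hb_def
  have hF : (tightSet (polyhedron a) a i).Nonempty := by
    rw [tightSet_eq_tightFace]; exact (ha _ hi.card_image.le).nonempty_tightFace
  have hG : (tightSet (polyhedron b) b i).Nonempty := by
    rw [tightSet_eq_tightFace]; exact (hb _ hi.card_image.le).nonempty_tightFace
  have hdef : Defines (∑ j, a (i j)) l (polyhedron b) (tightSet (polyhedron b) b i) := by
    -- The shifts cancel because a selection uses each color once; so one inequality defines both
    -- faces.
    have e : ∑ j, b (i j) = ∑ j, a (i j) := by
      simp [hb_def, shiftedNormals, hi _, Finset.sum_add_distrib, hsum]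
    rw [← e]
    exact defines_tightSet hi
  have hne : ∑ j, (a ∘ i) j ≠ 0 := by
    intro h0
    have := Fintype.linearIndependent_iff.1 (ha.linearIndependent_comp hi) (fun _ => 1)
      (by simpa using h0) ⟨0, hl⟩
    exact one_ne_zero this
  refine ⟨⟨?_, _, _, (defines_tightSet hi).cayley (convex_polyhedron a) (convex_polyhedron b)
    hdef hF hG⟩, ?_⟩
  · exact ⟨_, lift_zero_mem_cayley _ hF.some_mem⟩
  · have h1 := affDim_cayley hF hG
    rw [ha.orthogonal_vectorSpan_tightSet hi, hb.orthogonal_vectorSpan_tightSet hi,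
      hi.shiftedNormals_comp, span_inf_span_add_eq hl hV huV hu hsum,
      finrank_span_singleton hne] at h1
    have h2 := affDim_cayley (F := polyhedron a) (G := polyhedron b) ⟨0, zero_mem_polyhedron a⟩
      ⟨0, zero_mem_polyhedron b⟩
    rw [ha.vectorSpan_polyhedron, bot_inf_eq, finrank_bot] at h2
    omega

theorem injOn_cayley_tightSet {b : Fin k → EuclideanSpace ℝ (Fin n)} (ha : IsNeighborly l a)
    (hb : IsNeighborly l b) :
    Set.InjOn (fun i => cayley (tightSet (polyhedron a) a i) (tightSet (polyhedron b) b i))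
      {i | IsSelection κ i} := by
  intro i hi i' hi' e
  refine injOn_tightSet ha κ hi hi' ?_
  have key : ∀ i, IsSelection κ i → ∀ x, x ∈ tightSet (polyhedron a) a i ↔ lift 0 x ∈
      cayley (tightSet (polyhedron a) a i) (tightSet (polyhedron b) b i) := fun i hi x => by
    refine (lift_zero_mem_cayley_iff ((defines_tightSet hi).convex (convex_polyhedron a))
      ((defines_tightSet hi).convex (convex_polyhedron b)) ?_ ?_).symm
    · rw [tightSet_eq_tightFace]; exact (ha _ hi.card_image.le).nonempty_tightFace
    · rw [tightSet_eq_tightFace]; exact (hb _ hi.card_image.le).nonempty_tightFace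
  ext x
  change x ∈ tightSet (polyhedron a) a i ↔ x ∈ tightSet (polyhedron a) a i'
  rw [key i hi, key i' hi']
  exact Set.ext_iff.1 e _

end Shifted

theorem IsKPolytope.cayley_polyhedron {a b : Fin k → EuclideanSpace ℝ (Fin n)}
    (ha : IsNeighborly l a) (ha' : IsCoercive a) (hb' : IsCoercive b) :
    IsKPolytope (n + 1) (cayley (polyhedron a) (polyhedron b)) := by
  refine ⟨ha'.isPolytope.cayley hb'.isPolytope,
    ⟨_, lift_zero_mem_cayley _ (zero_mem_polyhedron a)⟩, ?_⟩
  have := affDim_cayley (F := polyhedron a) (G := polyhedron b) ⟨0, zero_mem_polyhedron a⟩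
      ⟨0, zero_mem_polyhedron b⟩
  rwa [ha.vectorSpan_polyhedron, bot_inf_eq, finrank_bot] at this

theorem exists_isBalancedColoring {d : ℕ} (hd : Even d) :
    ∃ κ : Fin (d ^ 2) → Fin (d / 2), IsBalancedColoring d κ := by
  have e : d ^ 2 = d / 2 * (2 * d) := by
    obtain ⟨l, rfl⟩ := hd
    rw [← two_mul, Nat.mul_div_cancel_left _ two_pos]
    ring
  let f : Fin (d ^ 2) ≃ Fin (d / 2) × Fin (2 * d) := (finCongr e).trans finProdFinEquiv.symm
  refine ⟨fun m => (f m).1, fun j => ?_⟩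
  have : {m | (f m).1 = j} = (fun q => f.symm (j, q)) '' Set.univ := by
    ext m
    constructor
    · rintro rfl
      exact ⟨(f m).2, trivial, by simp⟩
    · rintro ⟨q, -, rfl⟩
      simp
  rw [this, Set.ncard_image_of_injective, Set.ncard_univ, Nat.card_fin]
  intro q q' h
  simpa using h

end Selections

end CayleyConstruction

/-! ### The main theorem -/

theorem theorem6 :
    -- the existence statement, with `d^Ω(d)` spelled out
    (∃ c : ℝ, 0 < c ∧ ∀ d : ℕ, Even d → 2 ≤ d →
      ∃ P₁ P₂ : Set (EuclideanSpace ℝ (Fin d)),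
        CayleyConstruction.IsKPolytope d P₁ ∧
        CayleyConstruction.IsKPolytope d P₂ ∧
        (CayleyConstruction.facets P₁).ncard = d ^ 2 ∧
        (CayleyConstruction.facets P₂).ncard = d ^ 2 ∧
        CayleyConstruction.IsKPolytope (d + 1) (CayleyConstruction.cayley P₁ P₂) ∧
        (d : ℝ) ^ (c * (d : ℝ)) ≤
          ((CayleyConstruction.facets (CayleyConstruction.cayley P₁ P₂)).ncard : ℝ)) ∧
    -- the construction that realises it
    (∀ d : ℕ, Even d → 2 ≤ d →
      ∀ t : Fin (d ^ 2) → ℝ, Function.Injective t →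
        (interior (CayleyConstruction.cyclicPolytope d t)).Nonempty ∧
        ∀ v ∈ interior (CayleyConstruction.cyclicPolytope d t),
        ∀ κ : Fin (d ^ 2) → Fin (d / 2), CayleyConstruction.IsBalancedColoring d κ →
        ∀ ε : ℝ, 0 < ε →
        ∃ u : Fin (d / 2) → EuclideanSpace ℝ (Fin d),
          (∀ j, ‖u j‖ < ε) ∧
          ∃ (P₁ P₂ : Set (EuclideanSpace ℝ (Fin d)))
            (a b : Fin (d ^ 2) → EuclideanSpace ℝ (Fin d)),
            P₁ = CayleyConstruction.polarCyclic d t v ∧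
            a = CayleyConstruction.normals d t v ∧
            CayleyConstruction.IsAdmissibleShift P₁ u ∧
            b = CayleyConstruction.shiftedNormals a κ u ∧
            P₂ = CayleyConstruction.polyhedron b ∧
            -- the polytopes and their facets
            CayleyConstruction.IsKPolytope d P₁ ∧
            CayleyConstruction.IsKPolytope d P₂ ∧
            CayleyConstruction.facets P₁ =
              Set.range (fun m => {x | x ∈ P₁ ∧ inner ℝ (a m) x = 1}) ∧
            (CayleyConstruction.facets P₁).ncard = d ^ 2 ∧
            CayleyConstruction.facets P₂ =
              Set.range (fun m => {x | x ∈ P₂ ∧ inner ℝ (b m) x = 1}) ∧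
            (CayleyConstruction.facets P₂).ncard = d ^ 2 ∧
            CayleyConstruction.IsKPolytope (d + 1) (CayleyConstruction.cayley P₁ P₂) ∧
            -- corresponding colourful faces give facets of the Cayley embedding
            (∀ i : Fin (d / 2) → Fin (d ^ 2), CayleyConstruction.IsSelection κ i →
              CayleyConstruction.IsKFace (d / 2) P₁ (CayleyConstruction.tightSet P₁ a i) ∧
              CayleyConstruction.IsKFace (d / 2) P₂ (CayleyConstruction.tightSet P₂ b i) ∧
              CayleyConstruction.cayley (CayleyConstruction.tightSet P₁ a i)
                  (CayleyConstruction.tightSet P₂ b i) ∈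
                CayleyConstruction.facets (CayleyConstruction.cayley P₁ P₂)) ∧
            -- there are `(2d)^(d/2)` colourful faces, and as many facets arise from them
            {F | ∃ i, CayleyConstruction.IsSelection κ i ∧
              F = CayleyConstruction.tightSet P₁ a i}.ncard = (2 * d) ^ (d / 2) ∧
            {G | ∃ i, CayleyConstruction.IsSelection κ i ∧
              G = CayleyConstruction.cayley (CayleyConstruction.tightSet P₁ a i)
                (CayleyConstruction.tightSet P₂ b i)}.ncard = (2 * d) ^ (d / 2) ∧
            (2 * d) ^ (d / 2) ≤
              (CayleyConstruction.facets (CayleyConstruction.cayley P₁ P₂)).ncard) := by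
  refine (and_iff_right_of_imp ?_).2 ?_
  · intro h
    -- The construction gives `(2d)^(d/2) ≥ d^(d/2)` facets, so `c = 1/2` suffices.
    refine ⟨1 / 2, by norm_num, fun d hd hd2 => ?_⟩
    obtain ⟨⟨v, hv⟩, hall⟩ := h d hd hd2 (fun m => ((m : ℕ) : ℝ))
      (Nat.cast_injective.comp Fin.val_injective)
    obtain ⟨κ, hκ⟩ := CayleyConstruction.exists_isBalancedColoring hd
    obtain ⟨u, -, P₁, P₂, a, b, -, -, -, -, -, h1, h2, -, h3, -, h4, h5, -, -, -, h6⟩ :=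
      hall v hv κ hκ 1 one_pos
    refine ⟨P₁, P₂, h1, h2, h3, h4, h5, ?_⟩
    have e : (1 / 2 : ℝ) * d = ((d / 2 : ℕ) : ℝ) := by
      obtain ⟨l, rfl⟩ := hd
      rw [← two_mul, Nat.mul_div_cancel_left _ two_pos]
      push_cast
      ring
    rw [e, Real.rpow_natCast]
    exact_mod_cast (Nat.pow_le_pow_left (by omega : d ≤ 2 * d) _).trans h6
  · intro d hd hd2 t ht
    have hl : 0 < d / 2 := by omega
    have hdd : d / 2 + d / 2 = d := by
      obtain ⟨l, rfl⟩ := hd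
      omega
    have hlt : d < d ^ 2 := by nlinarith
    refine ⟨CayleyConstruction.interior_cyclicPolytope_nonempty hlt ht,
      fun v hv κ hκ ε hε => ?_⟩
    set a := CayleyConstruction.normals d t v with ha_def
    have ha : CayleyConstruction.IsNeighborly (d / 2) a :=
      CayleyConstruction.isNeighborly_normals (by omega) (by omega) ht hv
    have ha' : CayleyConstruction.IsCoercive a := CayleyConstruction.isCoercive_normals hv
    -- Shifts shorter than `η` keep the normals neighborly and coercive; they are chosen below `min
    -- ε η`.
    obtain ⟨η, hη, hball⟩ := Metric.eventually_nhds_iff.1 (ha.eventually.and ha'.eventually)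
    obtain ⟨u, hnorm, hadm, hsum, V, huV, hV⟩ :=
      CayleyConstruction.exists_admissible_shift hd hd2 a (lt_min hε hη)
    obtain ⟨hb, hb'⟩ := @hball (CayleyConstruction.shiftedNormals a κ u)
      ((dist_pi_lt_iff hη).2 fun m => by
        rw [dist_eq_norm, CayleyConstruction.shiftedNormals, add_sub_cancel_left]
        exact (hnorm _).trans_le (min_le_right _ _))
    set b := CayleyConstruction.shiftedNormals a κ u with hb_def
    have hfacet : ∀ i : Fin (d / 2) → Fin (d ^ 2), CayleyConstruction.IsSelection κ i →
        CayleyConstruction.cayley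
            (CayleyConstruction.tightSet (CayleyConstruction.polyhedron a) a i)
            (CayleyConstruction.tightSet (CayleyConstruction.polyhedron b) b i) ∈
          CayleyConstruction.facets (CayleyConstruction.cayley (CayleyConstruction.polyhedron a)
            (CayleyConstruction.polyhedron b)) := fun i hi => by
      refine CayleyConstruction.cayley_tightSet_mem_facets hl ha hb hi ?_ huV hadm.2.1 hsum
      have hrange : Set.range (a ∘ i) = a '' Set.range i := Set.range_comp a i
      rw [hrange]
      refine hV _ ?_
      rw [← hrange, finrank_span_eq_card (ha.linearIndependent_comp hi), Fintype.card_fin]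
    have hpoly := CayleyConstruction.IsKPolytope.cayley_polyhedron ha ha' hb'
    have hcount : {G | ∃ i, CayleyConstruction.IsSelection κ i ∧
        G = CayleyConstruction.cayley
          (CayleyConstruction.tightSet (CayleyConstruction.polyhedron a) a i)
          (CayleyConstruction.tightSet (CayleyConstruction.polyhedron b) b i)}.ncard =
        (2 * d) ^ (d / 2) := by
      rw [← CayleyConstruction.ncard_isSelection hκ,
        ← (CayleyConstruction.injOn_cayley_tightSet ha hb).ncard_image]
      congr 1
      ext G
      simp [eq_comm]
    refine ⟨u, fun j => (hnorm j).trans_le (min_le_left _ _), CayleyConstruction.polyhedron a,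
      CayleyConstruction.polyhedron b, a, b,
      (CayleyConstruction.polarCyclic_eq_polyhedron t v).symm, rfl, hadm, rfl, rfl,
      ha'.isKPolytope ha, hb'.isKPolytope hb, (ha.mono hl).facets_polyhedron,
      (ha.mono hl).ncard_facets, (hb.mono hl).facets_polyhedron, (hb.mono hl).ncard_facets,
      hpoly, fun i hi => ⟨ha.isKFace_tightSet hi hdd, hb.isKFace_tightSet hi hdd, hfacet i hi⟩,
      ?_, hcount, ?_⟩
    · rw [← CayleyConstruction.ncard_isSelection hκ,
        ← (CayleyConstruction.injOn_tightSet ha κ).ncard_image]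
      congr 1
      ext F
      simp [eq_comm]
    · rw [← hcount]
      refine Set.ncard_le_ncard ?_ hpoly.1.finite_facets
      rintro _ ⟨i, hi, rfl⟩
      exact hfacet i hi
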